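/- Let $d\ge 1$, $S=\mathbb{R}^d\times\mathbb{R}\times(0,\infty)$, let $\pi$ be a probability measure on $(0,\infty)$ (for instance $\pi(\mathrm{d}\lambda)=f(\lambda)\,\mathrm{d}\lambda$ with a probability density $f$), and put $\tilde c(\mathrm{d}\xi,\mathrm{d}s,\mathrm{d}\lambda)=\mathrm{d}\xi\,\mathrm{d}s\,\pi(\mathrm{d}\lambda)$. Let $L$ be a Lévy basis on $S$, that is, an independently scattered, infinitely divisible random measure $(L(E))$ indexed by the bounded Borel sets $E\subseteq S$, with finite second moments and with characteristic quadruplet $(a,b,\nu,\tilde c)$, where $a\in\mathbb{R}$, $b\ge 0$ and $\nu$ is a Lévy measure on $\mathbb{R}$: $$\mathbb{E}\,e^{i\theta L(E)}=e^{\tilde c(E)\psi(\theta)},\qquad \psi(\theta)=i\theta a-\tfrac12\theta^2b+\int_{\mathbb{R}}\bigl(e^{i\theta z}-1-i\theta z\mathbf 1_{|z|\le 1}\bigr)\,\nu(\mathrm{d}z).$$ Let $g:[0,\infty)\to[0,\infty)$ be non-decreasing with $g(w)>0$ for $w>0$, and let $$A_t(x)=\{(\xi,s)\in\mathbb{R}^d\times\mathbb{R}:\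 s\le t,\ |x-\xi|\le g(|t-s|)\}.$$ Assume that $\int_0^\infty\int_{A_t(x)}e^{-\lambda(t-s)}\,\mathrm{d}\xi\,\mathrm{d}s\,\pi(\mathrm{d}\lambda)<\infty$ and $\int_0^\infty\int_{A_t(x)}e^{-2\lambda(t-s)}\,\mathrm{d}\xi\,\mathrm{d}s\,\pi(\mathrm{d}\lambda)<\infty$ for all $t$ and $x$, and let $Y$ be the $g$-class MSTOU process $$Y_t(x)=\int_0^\infty\int_{A_t(x)}e^{-\lambda(t-s)}\,L(\mathrm{d}\xi,\mathrm{d}s,\mathrm{d}\lambda).$$ The stochastic integral of a measurable function $h$ over $S$ is the limit in probability of the integrals over $S$ of simple functions $h_n$ (finite linear combinations of indicators of disjoint bounded Borel sets) that converge to $h$ $\tilde c$-almost everywhere and whose integrals over every Borel subset of $S$ converge in probability. Then $Y$ is isotropic in space: every $Y_t(x)$ has a finite second moment, and there is a function $C:\mathbb{R}\to\mathbb{R}$ such that $$\operatorname{Cov}\bigl(Y_t(x),Y_t(x+d_x)\bigr)=C(|d_x|)\qquad\text{for all } t\in\mathbb{R},\ x,d_x\in\mathbb{R}^d,$$ and $C$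 is positive definite, i.e. $\sum_{i,j}w_iw_jC(|x_i-x_j|)\ge 0$ for all finite families $x_i\in\mathbb{R}^d$ and $w_i\in\mathbb{R}$. Moreover, there is a Lévy seed $L'$, a random variable with $\mathbb{E}\,e^{i\theta L'}=e^{\psi(\theta)}$, and it has a finite second moment. For all $t$, $x$, $d_x$ and all $p,q\in\mathbb{R}^d$ with $|p-q|=|d_x|$, $$\operatorname{Cov}\bigl(Y_t(x),Y_t(x+d_x)\bigr)=\operatorname{Var}(L')\int_0^\infty\int_{-\infty}^t \operatorname{vol}\bigl(\bar B(p,g(t-s))\cap\bar B(q,g(t-s))\bigr)\,e^{-2\lambda(t-s)}\,\mathrm{d}s\,\pi(\mathrm{d}\lambda),$$ where $\bar B(p,r)$ is the closed ball of radius $r$ with centre $p$, and the integral converges. -/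

import Mathlib

open MeasureTheory ProbabilityTheory Filter Topology Set
open scoped ENNReal

noncomputable section

namespace MSTOU

/-- Space `ℝ^d`, with its Euclidean norm. -/
abbrev Space (d : ℕ) : Type := EuclideanSpace ℝ (Fin d)

/-- The set `(0, ∞)` of rate parameters. -/
abbrev Rate : Type := Set.Ioi (0 : ℝ)

/-- `S = ℝ^d × ℝ × (0, ∞)`, with points `(ξ, s, lam)`. -/
abbrev S (d : ℕ) : Type := Space d × ℝ × Rate

/-- The measure `dξ ds π(dlam)` on `S`. -/
def control (d : ℕ) (π : Measure Rate) : Measure (S d) :=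
  (volume : Measure (Space d)).prod ((volume : Measure ℝ).prod π)

/-- The bounded Borel sets of `S`, on which a Lévy basis is defined. -/
def IsBddBorel {d : ℕ} (E : Set (S d)) : Prop :=
  MeasurableSet E ∧ Bornology.IsBounded E

/-! ### Lévy bases -/

/-- The `n`-fold convolution of `μ` with itself. -/
def convPow {k : ℕ} (μ : Measure (Fin k → ℝ)) (n : ℕ) : Measure (Fin k → ℝ) :=
  (fun ρ : Measure (Fin k → ℝ) => ρ.conv μ)^[n] (Measure.dirac 0)

/-- `μ` is an infinitely divisible law on `ℝ^k`. -/
def IsInfDivisible {k : ℕ} (μ : Measure (Fin k → ℝ)) : Prop :=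
  ∀ n : ℕ, 1 ≤ n →
    ∃ ρ : Measure (Fin k → ℝ), IsProbabilityMeasure ρ ∧ μ = convPow ρ n

/-- `L` is a Lévy basis on `S`: an independently scattered, infinitely divisible random measure
indexed by the bounded Borel sets. (Only the values of `L` at bounded Borel sets matter.) -/
structure IsLevyBasis {d : ℕ} {Ω : Type*} [MeasurableSpace Ω] (P : Measure Ω)
    (L : Set (S d) → Ω → ℝ) : Prop where
  measurable : ∀ E : Set (S d), IsBddBorel E → Measurable (L E)
  /-- Countable additivity. The sum is a limit of partial sums: it need not converge absolutely. -/
  sigma_additive : ∀ E : ℕ → Set (S d), (∀ j, IsBddBorel (E j)) →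
    Pairwise (fun i j => Disjoint (E i) (E j)) → IsBddBorel (⋃ j, E j) →
    ∀ᵐ ω ∂P, Tendsto (fun n : ℕ => ∑ j ∈ Finset.range n, L (E j) ω) atTop
      (𝓝 (L (⋃ j, E j) ω))
  indep : ∀ E F : Set (S d), IsBddBorel E → IsBddBorel F → Disjoint E F →
    IndepFun (L E) (L F) P
  infDivisible : ∀ (k : ℕ) (B : Fin k → Set (S d)), (∀ i, IsBddBorel (B i)) →
    IsInfDivisible (P.map (fun ω => fun i => L (B i) ω))

/-- `ν` is a Lévy measure on `ℝ`. -/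
def IsLevyMeasure (ν : Measure ℝ) : Prop :=
  ν {0} = 0 ∧ ∫⁻ z, ENNReal.ofReal (min 1 (z ^ 2)) ∂ν < ∞

/-- The Lévy–Khintchine exponent
`iθa - θ²b/2 + ∫ (e^{iθz} - 1 - iθz 1_{|z| ≤ 1}) ν(dz)`. -/
def levyExponent (a b : ℝ) (ν : Measure ℝ) (θ : ℝ) : ℂ :=
  Complex.I * θ * a - (1 / 2 : ℂ) * (θ : ℂ) ^ 2 * b +
    ∫ z : ℝ, (Complex.exp (Complex.I * θ * z) - 1 -
      Complex.I * θ * (if |z| ≤ 1 then (z : ℂ) else 0)) ∂ν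

/-- `L` has characteristic quadruplet `(a, b, ν, c)`, where `a`, `b` and `ν` do not depend on the
point of `S`: the cumulant generating function of `L(E)` is `c(E)` times the exponent of
`(a, b, ν)`. -/
def HasCharQuadruplet {d : ℕ} {Ω : Type*} [MeasurableSpace Ω] (P : Measure Ω)
    (L : Set (S d) → Ω → ℝ) (a b : ℝ) (ν : Measure ℝ) (c : Measure (S d)) : Prop :=
  0 ≤ b ∧ IsLevyMeasure ν ∧
    ∀ E : Set (S d), IsBddBorel E → ∀ θ : ℝ,
      charFun (P.map (L E)) θ = Complex.exp ((c.real E : ℂ) * levyExponent a b ν θ)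

/-- `σ` is the law of the Lévy seed with triplet `(a, b, ν)`. -/
def IsLevySeedLaw (a b : ℝ) (ν σ : Measure ℝ) : Prop :=
  IsProbabilityMeasure σ ∧ ∀ θ : ℝ, charFun σ θ = Complex.exp (levyExponent a b ν θ)

/-- The Lévy basis has finite second moments. -/
def HasFiniteSecondMoments {d : ℕ} {Ω : Type*} [MeasurableSpace Ω] (P : Measure Ω)
    (L : Set (S d) → Ω → ℝ) : Prop :=
  ∀ E : Set (S d), IsBddBorel E → MemLp (L E) 2 P

/-! ### Stochastic integrals -/

/-- A simple function `∑ j, y j * 1_{E j}` on `S`, with disjoint bounded Borel sets `E j`. -/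
structure SimpleFn (d : ℕ) where
  m : ℕ
  y : Fin m → ℝ
  E : Fin m → Set (S d)
  bddBorel : ∀ j, IsBddBorel (E j)
  disjoint : Pairwise (fun i j => Disjoint (E i) (E j))

/-- The value of a simple function at a point. -/
def SimpleFn.eval {d : ℕ} (h : SimpleFn d) (z : S d) : ℝ :=
  ∑ j, (h.E j).indicator (fun _ => h.y j) z

/-- The stochastic integral of a simple function over `A`. -/
def SimpleFn.integral {d : ℕ} {Ω : Type*} (h : SimpleFn d) (L : Set (S d) → Ω → ℝ)
    (A : Set (S d)) (ω : Ω) : ℝ :=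
  ∑ j, h.y j * L (A ∩ h.E j) ω

/-- `h` is `L`-integrable and `Z` is (a version of) its stochastic integral `∫_S h dL`;
here `c` is the control measure of `L`. -/
def IsStochIntegral {d : ℕ} {Ω : Type*} [MeasurableSpace Ω] (P : Measure Ω)
    (L : Set (S d) → Ω → ℝ) (c : Measure (S d)) (h : S d → ℝ) (Z : Ω → ℝ) : Prop :=
  Measurable h ∧ ∃ hn : ℕ → SimpleFn d,
    (∀ᵐ z ∂c, Tendsto (fun n => (hn n).eval z) atTop (𝓝 (h z))) ∧
    (∀ A : Set (S d), MeasurableSet A →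
      ∃ ZA : Ω → ℝ, TendstoInMeasure P (fun n => (hn n).integral L A) atTop ZA) ∧
    TendstoInMeasure P (fun n => (hn n).integral L Set.univ) atTop Z

/-! ### MSTOU processes -/

/-- The conditions on a family of ambit sets `A t x ⊆ ℝ^d × ℝ`: translation invariance,
monotonicity in time and non-anticipation. -/
structure IsAmbit {d : ℕ} (A : ℝ → Space d → Set (Space d × ℝ)) : Prop where
  translation : ∀ t x, A t x = (fun p => p + (x, t)) '' A 0 0
  mono : ∀ s t x, s < t → A s x ⊆ A t x
  nonanticipative : ∀ t x, A t x ∩ (Set.univ ×ˢ Set.Ioi t) = ∅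

/-- The points `(ξ, s, lam)` of `S` with `(ξ, s)` in `B`. -/
def cylinder {d : ℕ} (B : Set (Space d × ℝ)) : Set (S d) :=
  {z | (z.1, z.2.1) ∈ B}

/-- The integrand `1_{A_t(x)}(ξ, s) exp(-lam (t - s))`. -/
def kernel {d : ℕ} (A : ℝ → Space d → Set (Space d × ℝ)) (t : ℝ) (x : Space d) : S d → ℝ :=
  (cylinder (A t x)).indicator (fun z => Real.exp (-(z.2.2 : ℝ) * (t - z.2.1)))

/-- `Y` is the MSTOU process `Y_t(x) = ∫_0^∞ ∫_{A_t(x)} exp(-lam (t - s)) L(dξ, ds, dlam)`, where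
`L` is a Lévy basis with characteristic quadruplet `(a, b, ν, dξ ds π(dlam))` and finite second
moments, and where the integrability conditions for such processes hold. -/
structure IsMSTOU {d : ℕ} {Ω : Type*} [MeasurableSpace Ω] (P : Measure Ω)
    (L : Set (S d) → Ω → ℝ) (a b : ℝ) (ν : Measure ℝ) (π : Measure Rate)
    (A : ℝ → Space d → Set (Space d × ℝ)) (Y : ℝ → Space d → Ω → ℝ) : Prop where
  levyBasis : IsLevyBasis P L
  quadruplet : HasCharQuadruplet P L a b ν (control d π)
  finiteSecondMoments : HasFiniteSecondMoments P L
  ambit : IsAmbit A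
  integrable_one : ∀ t x, ∫⁻ z in cylinder (A t x),
    ENNReal.ofReal (Real.exp (-(z.2.2 : ℝ) * (t - z.2.1))) ∂(control d π) < ∞
  integrable_two : ∀ t x, ∫⁻ z in cylinder (A t x),
    ENNReal.ofReal (Real.exp (-2 * (z.2.2 : ℝ) * (t - z.2.1))) ∂(control d π) < ∞
  integral_eq : ∀ t x, IsStochIntegral P L (control d π) (kernel A t x) (Y t x)

/-- The ambit sets of the `g`-class. -/
def gAmbit {d : ℕ} (g : ℝ → ℝ) (t : ℝ) (x : Space d) : Set (Space d × ℝ) :=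
  {p | p.2 ≤ t ∧ ‖x - p.1‖ ≤ g |t - p.2|}

/-! ### Isotropy -/

/-- `C` is positive definite as a radial function on `ℝ^d`. -/
def IsRadialPosDef (d : ℕ) (C : ℝ → ℝ) : Prop :=
  ∀ (k : ℕ) (x : Fin k → Space d) (w : Fin k → ℝ),
    0 ≤ ∑ i, ∑ j, w i * w j * C ‖x i - x j‖

/-- The process `Y` has finite second moments and is isotropic in space. -/
def IsIsotropic {d : ℕ} {Ω : Type*} [MeasurableSpace Ω] (P : Measure Ω)
    (Y : ℝ → Space d → Ω → ℝ) : Prop :=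
  (∀ t x, MemLp (Y t x) 2 P) ∧
    ∃ C : ℝ → ℝ, IsRadialPosDef d C ∧
      ∀ (t : ℝ) (x dx : Space d), cov[Y t x, Y t (x + dx); P] = C ‖dx‖

/-- The volume of the intersection of the two closed balls of radius `r` with centres `p`, `q`. -/
def lensVolume {d : ℕ} (p q : Space d) (r : ℝ) : ℝ :=
  volume.real (Metric.closedBall p r ∩ Metric.closedBall q r)

end MSTOU

end

/-! The covariance is computed by realizing the stochastic integral as a map into `L²(P)` and then
reading off the geometry of the kernels.

Write `c` for the control measure, and `m`, `v` for the mean and variance of the seed law.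
Differentiating characteristic functions at zero gives `L(E)` the mean `c(E) m` and variance `c(E)
v`; independence on disjoint sets then gives `Cov(L(E), L(F)) = v c(E ∩ F)`
(`covariance_levyBasis`). So the centred values of `L` have `v` times the Gram matrix of the
indicators in `L²(c)`, and indicators extend to `√v` times an isometry. Adding back `m ∫ f` yields
an integral `I` on `L¹ ∩ L²` with `Cov(I f, I g) = v ∫ f g dc` (`exists_isL2Integral`).

The delicate point is that the stochastic integral is defined through arbitrary simple functions
converging only almost everywhere, with integrals converging only in probability. Convergence over
every Borel set forces the limit to be `I h`, by a Vitali–Hahn–Saks argument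
(`IsL2Integral.tendsto_zero_of_cauchy`, `IsStochIntegral.ae_eq`).

For two kernels at the same time, Fubini turns `∫ f g dc` into an integral of lens volumes. A lens
volume depends only on the distance of the centres, whence isotropy; positive definiteness holds
because the quadratic form is a variance. -/

namespace MSTOU

/-! ### Integrals on `L¹ ∩ L²` and the Vitali–Hahn–Saks argument -/

section VitaliHahnSaks

variable {α E : Type*} [MeasurableSpace α] [NormedAddCommGroup E]

/-- Functions that are both integrable and square integrable. -/
def MemL1L2 (f : α → ℝ) (c : Measure α) : Prop := Integrable f c ∧ MemLp f 2 c

/-- An integral defined on `L¹ ∩ L²`, additive and dominated by the two norms. -/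
structure IsL2Integral (c : Measure α) (A B : ℝ) (I : (α → ℝ) → E) : Prop where
  add : ∀ f g, MemL1L2 f c → MemL1L2 g c → I (f + g) = I f + I g
  norm_sq_le : ∀ f, MemL1L2 f c → ‖I f‖ ^ 2 ≤ A * ∫ z, f z ^ 2 ∂c + B * (∫ z, f z ∂c) ^ 2

variable {c : Measure α} {A B : ℝ} {I : (α → ℝ) → E}

theorem MemL1L2.sub {f g : α → ℝ} (hf : MemL1L2 f c) (hg : MemL1L2 g c) : MemL1L2 (f - g) c :=
  ⟨hf.1.sub hg.1, hf.2.sub hg.2⟩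

theorem MemL1L2.indicator {f : α → ℝ} (hf : MemL1L2 f c) {s : Set α} (hs : MeasurableSet s) :
    MemL1L2 (s.indicator f) c :=
  ⟨hf.1.indicator hs, hf.2.indicator hs⟩

theorem MemL1L2.abs {f : α → ℝ} (hf : MemL1L2 f c) : MemL1L2 (fun z => |f z|) c :=
  ⟨hf.1.abs, hf.2.abs⟩

theorem MemL1L2.mono {f F : α → ℝ} (hF : MemL1L2 F c) (hf : AEStronglyMeasurable f c)
    (h : ∀ᵐ z ∂c, |f z| ≤ F z) : MemL1L2 f c :=
  ⟨hF.1.mono' hf h, hF.2.mono' hf h⟩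

theorem memL1L2_indicator_const {s : Set α} (hs : MeasurableSet s) (hc : c s ≠ ∞) (r : ℝ) :
    MemL1L2 (s.indicator fun _ => r) c :=
  ⟨(integrable_indicator_iff hs).2 (integrableOn_const hc), memLp_indicator_const 2 hs r (Or.inr hc)⟩

theorem IsL2Integral.sub (hI : IsL2Integral c A B I) {f g : α → ℝ} (hf : MemL1L2 f c)
    (hg : MemL1L2 g c) : I (f - g) = I f - I g := by
  have := hI.add (f - g) g (hf.sub hg) hg
  rw [sub_add_cancel] at this
  rw [this, add_sub_cancel_right]

/-- The norm bound applied to `f n - h` leaves two scalar integrals, of the difference and of its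
square. Dominated convergence handles both, which is why the dominating function must lie in `L¹`
and in `L²`. -/
theorem IsL2Integral.tendsto_of_dominated (hI : IsL2Integral c A B I) {f : ℕ → α → ℝ}
    {h F : α → ℝ} (hF : MemL1L2 F c) (hf : ∀ n, AEStronglyMeasurable (f n) c)
    (hle : ∀ n, ∀ᵐ z ∂c, |f n z| ≤ F z)
    (hlim : ∀ᵐ z ∂c, Tendsto (fun n => f n z) atTop (𝓝 (h z))) :
    Tendsto (fun n => I (f n)) atTop (𝓝 (I h)) := by
  have hfn n : MemL1L2 (f n) c := hF.mono (hf n) (hle n)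
  have hhle : ∀ᵐ z ∂c, |h z| ≤ F z := by
    filter_upwards [hlim, ae_all_iff.2 hle] with z hz hz'
    exact le_of_tendsto hz.abs (Eventually.of_forall hz')
  have hh : MemL1L2 h c := hF.mono (aestronglyMeasurable_of_tendsto_ae atTop hf hlim) hhle
  have hd n := (hfn n).sub hh
  have hdle : ∀ n, ∀ᵐ z ∂c, |f n z - h z| ≤ 2 * F z := fun n => by
    filter_upwards [hle n, hhle] with z h1 h2
    linarith [abs_sub (f n z) (h z)]
  have t1 : Tendsto (fun n => ∫ z, (f n - h) z ∂c) atTop (𝓝 (∫ _, (0 : ℝ) ∂c)) := by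
    refine tendsto_integral_of_dominated_convergence (fun z => 2 * F z)
      (fun n => (hd n).1.aestronglyMeasurable) (hF.1.const_mul 2) hdle ?_
    filter_upwards [hlim] with z hz
    simpa using hz.sub_const (h z)
  have t2 : Tendsto (fun n => ∫ z, (f n - h) z ^ 2 ∂c) atTop (𝓝 (∫ _, (0 : ℝ) ∂c)) := by
    refine tendsto_integral_of_dominated_convergence (fun z => (2 * F z) ^ 2)
      (fun n => (hd n).1.aestronglyMeasurable.pow 2) (hF.2.const_mul 2).integrable_sq ?_ ?_
    · intro n
      filter_upwards [hdle n] with z hz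
      rw [Real.norm_eq_abs, abs_pow]
      exact pow_le_pow_left₀ (abs_nonneg _) hz 2
    · filter_upwards [hlim] with z hz
      simpa using (hz.sub_const (h z)).pow 2
  have t3 : Tendsto (fun n => ‖I (f n) - I h‖ ^ 2) atTop (𝓝 0) := by
    simp_rw [← hI.sub (hfn _) hh]
    refine squeeze_zero (fun _ => sq_nonneg _) (fun n => hI.norm_sq_le _ (hd n)) ?_
    simpa using (t2.const_mul A).add ((t1.pow 2).const_mul B)
  rw [tendsto_iff_norm_sub_tendsto_zero]
  simpa using t3.sqrt

/-- A symmetric subadditive function dominated by the norm. -/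
structure IsSubNorm (q : E → ℝ) : Prop where
  le_norm : ∀ x, q x ≤ ‖x‖
  add_le : ∀ x y, q (x + y) ≤ q x + q y
  neg : ∀ x, q (-x) = q x
  nonneg : ∀ x, 0 ≤ q x

theorem IsSubNorm.sub_le {q : E → ℝ} (hq : IsSubNorm q) (x y : E) : q (x - y) ≤ q x + q y := by
  rw [sub_eq_add_neg, ← hq.neg y]
  exact hq.add_le _ _

theorem IsSubNorm.continuous {q : E → ℝ} (hq : IsSubNorm q) : Continuous q := by
  have key : ∀ x y, q x - q y ≤ ‖x - y‖ := fun x y => by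
    have h := hq.add_le (x - y) y
    rw [sub_add_cancel] at h
    linarith [hq.le_norm (x - y)]
  refine LipschitzWith.continuous (K := 1) (LipschitzWith.of_dist_le_mul fun x y => ?_)
  rw [Real.dist_eq, dist_eq_norm, NNReal.coe_one, one_mul, abs_le]
  constructor
  · have := key y x
    rw [norm_sub_rev] at this
    linarith
  · exact key x y

theorem IsSubNorm.tendsto_zero {q : E → ℝ} (hq : IsSubNorm q) {x : ℕ → E}
    (h : Tendsto x atTop (𝓝 0)) : Tendsto (fun n => q (x n)) atTop (𝓝 0) :=
  squeeze_zero (fun _ => hq.nonneg _) (fun _ => hq.le_norm _) (by simpa using h.norm)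

/-- A measurable level function along which a pointwise bounded sequence is uniformly bounded. -/
theorem exists_level {f : ℕ → α → ℝ} (hf : ∀ n, Measurable (f n)) {S : ℕ → Set α}
    (hS : ∀ k, MeasurableSet (S k)) (hSm : Monotone S) (hSu : ⋃ k, S k = univ)
    (hlim : ∀ᵐ z ∂c, Tendsto (fun n => f n z) atTop (𝓝 0)) :
    ∃ κ : α → ℕ, Measurable κ ∧ ∀ᵐ z ∂c, ∀ k, κ z ≤ k → z ∈ S k ∧ ∀ n, |f n z| ≤ k := by
  classical
  -- The second alternative makes `Nat.find` total: points without a level, a null set, get the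
  -- value 0.
  let p : α → ℕ → Prop := fun z k => (z ∈ S k ∧ ∀ n, |f n z| ≤ k) ∨ ¬ ∃ k : ℕ, z ∈ S k ∧ ∀ n, |f n z| ≤ k
  have hp : ∀ z, ∃ k, p z k := fun z => by
    by_cases h : ∃ k : ℕ, z ∈ S k ∧ ∀ n, |f n z| ≤ k
    · obtain ⟨k, hk⟩ := h
      exact ⟨k, Or.inl hk⟩
    · exact ⟨0, Or.inr h⟩
  have hG : ∀ k : ℕ, MeasurableSet {z | z ∈ S k ∧ ∀ n, |f n z| ≤ k} := fun k => by
    refine (hS k).inter (?_ : MeasurableSet {z | ∀ n, |f n z| ≤ k})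
    rw [Set.ofPred_forall]
    exact MeasurableSet.iInter fun n => measurableSet_le (hf n).abs measurable_const
  have hpm : ∀ k, MeasurableSet {z | p z k} := fun k => by
    refine (hG k).union (?_ : MeasurableSet {z | ¬ ∃ k : ℕ, z ∈ S k ∧ ∀ n, |f n z| ≤ k})
    refine MeasurableSet.compl (s := {z | ∃ k : ℕ, z ∈ S k ∧ ∀ n, |f n z| ≤ k}) ?_
    rw [Set.ofPred_exists]
    exact MeasurableSet.iUnion hG
  refine ⟨fun z => Nat.find (hp z), measurable_find hp hpm, ?_⟩
  filter_upwards [hlim] with z hz k hk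
  have hex : ∃ k : ℕ, z ∈ S k ∧ ∀ n, |f n z| ≤ k := by
    obtain ⟨r, hr⟩ := hz.abs.bddAbove_range
    obtain ⟨i, hi⟩ := mem_iUnion.1 (hSu.symm ▸ mem_univ z)
    obtain ⟨j, hj⟩ := exists_nat_ge r
    refine ⟨max i j, hSm (le_max_left i j) hi, fun n => ?_⟩
    have : |f n z| ≤ r := hr ⟨n, rfl⟩
    exact this.trans (hj.trans (by exact_mod_cast le_max_right i j))
  rcases Nat.find_spec (hp z) with h | h
  · exact ⟨hSm hk h.1, fun n => (h.2 n).trans (by exact_mod_cast hk)⟩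
  · exact absurd hex h

/-- The Vitali–Hahn–Saks argument: a sequence tending to zero almost everywhere whose
integrals over every measurable set are Cauchy has integrals tending to zero. -/
theorem IsL2Integral.tendsto_zero_of_cauchy (hI : IsL2Integral c A B I) {q : E → ℝ}
    (hq : IsSubNorm q) {f : ℕ → α → ℝ} (hfm : ∀ n, Measurable (f n))
    (hf : ∀ n, MemL1L2 (f n) c) {S : ℕ → Set α}
    (hS : ∀ k, MeasurableSet (S k)) (hSm : Monotone S) (hSu : ⋃ k, S k = univ)
    (hSc : ∀ k, c (S k) ≠ ∞)
    (hlim : ∀ᵐ z ∂c, Tendsto (fun n => f n z) atTop (𝓝 0))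
    (hcau : ∀ s, MeasurableSet s → ∀ ε > 0, ∃ N, ∀ n ≥ N, ∀ m ≥ N,
      q (I (s.indicator (f n)) - I (s.indicator (f m))) ≤ ε) :
    Tendsto (fun n => q (I (f n))) atTop (𝓝 0) := by
  obtain ⟨κ, hκ, hκS⟩ := exists_level hfm hS hSm hSu hlim
  have hsm : ∀ s : Set ℕ, MeasurableSet (κ ⁻¹' s) := fun s => hκ (MeasurableSet.of_discrete)
  have hI0 : I 0 = 0 := by
    have h0 : MemL1L2 (0 : α → ℝ) c := ⟨integrable_zero _ _ _, MemLp.zero⟩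
    have := hI.sub h0 h0
    simpa using this
  -- Unions of level sets of `κ` are coded by points of the Cantor space, a Baire space on which
  -- each `lam n` is continuous by dominated convergence.
  let lam : ℕ → (ℕ → Bool) → E := fun n J => I ((κ ⁻¹' {k | J k = true}).indicator (f n))
  have hcont : ∀ n, Continuous (lam n) := fun n => by
    refine continuous_iff_seqContinuous.2 fun J J₀ hJ => ?_
    refine hI.tendsto_of_dominated (hf n).abs
      (fun i => ((hfm n).indicator (hsm _)).aestronglyMeasurable) 
      (fun i => Eventually.of_forall fun z => norm_indicator_le_norm_self (f n) z) ?_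
    · refine Eventually.of_forall fun z => ?_
      have h1 : ∀ᶠ i in atTop, J i (κ z) = J₀ (κ z) := by
        have := (tendsto_pi_nhds.1 hJ) (κ z)
        exact this.eventually (IsOpen.mem_nhds (isOpen_discrete {J₀ (κ z)}) rfl)
      refine tendsto_const_nhds.congr' ?_
      filter_upwards [h1] with i hi
      simp only [indicator, mem_preimage, Set.mem_ofPred_eq, hi]
  rw [Metric.tendsto_atTop]
  intro ε' hε'
  -- The final estimate costs `ε` for the bulk, `2ε` for the difference of tails and `ε` for the
  -- tail of `f N`.
  obtain ⟨ε, hε, hεε'⟩ : ∃ ε > 0, 5 * ε < ε' := ⟨ε' / 6, by linarith, by linarith⟩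
  let F : ℕ → Set (ℕ → Bool) := fun N => {J | ∀ n ≥ N, ∀ m ≥ N, q (lam n J - lam m J) ≤ ε}
  have hFc : ∀ N, IsClosed (F N) := fun N => by
    simp only [F, Set.ofPred_forall]
    refine isClosed_iInter fun n => isClosed_iInter fun _ => isClosed_iInter fun m =>
      isClosed_iInter fun _ => ?_
    exact isClosed_le (hq.continuous.comp ((hcont n).sub (hcont m))) continuous_const
  have hFu : ⋃ N, F N = univ := by
    refine eq_univ_of_forall fun J => ?_
    obtain ⟨N, hN⟩ := hcau _ (hsm {k | J k = true}) ε hε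
    exact mem_iUnion.2 ⟨N, hN⟩
  -- Baire: the Cauchy property, known for each `J` separately, is uniform with a single `N` near
  -- some `J₀`.
  obtain ⟨N, J₀, hJ₀⟩ := nonempty_interior_of_iUnion_of_closed hFc hFu
  -- a cylinder around `J₀`
  obtain ⟨K, hK⟩ : ∃ K : ℕ, ∀ J : ℕ → Bool, (∀ k < K, J k = J₀ k) → J ∈ F N := by
    obtain ⟨s, hs⟩ : ∃ s : Finset ℕ, ∀ J : ℕ → Bool, (∀ k ∈ s, J k = J₀ k) → J ∈ F N := by
      have := mem_interior_iff_mem_nhds.1 hJ₀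
      rw [nhds_pi, Filter.mem_pi] at this
      obtain ⟨s, hs, t, ht, hst⟩ := this
      refine ⟨hs.toFinset, fun J hJ => hst fun k hk => ?_⟩
      rw [hJ k (hs.mem_toFinset.2 hk)]
      exact mem_of_mem_nhds (ht k)
    obtain ⟨K, hK⟩ := s.exists_nat_subset_range
    exact ⟨K, fun J hJ => hs J fun k hk => hJ k (Finset.mem_range.1 (hK hk))⟩
  have htail : ∀ K' ≥ K, ∀ n ≥ N, ∀ m ≥ N,
      q (I ((κ ⁻¹' Ici K').indicator (f n)) - I ((κ ⁻¹' Ici K').indicator (f m))) ≤ 2 * ε := by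
    intro K' hK' n hn m hm
    -- `J1` and `J2` both lie in the cylinder around `J₀` and differ exactly by the tail, so the
    -- tail inherits the uniform bound, doubled.
    let J1 : ℕ → Bool := fun k => if k < K' then J₀ k else false
    let J2 : ℕ → Bool := fun k => if k < K' then J₀ k else true
    have h1 : J1 ∈ F N := hK _ fun k hk => by simp [J1, hk.trans_le hK']
    have h2 : J2 ∈ F N := hK _ fun k hk => by simp [J2, hk.trans_le hK']
    have hdec : ∀ n, I ((κ ⁻¹' Ici K').indicator (f n)) = lam n J2 - lam n J1 := fun n => by
      rw [← hI.sub ((hf n).indicator (hsm _)) ((hf n).indicator (hsm _))]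
      congr 1
      ext z
      by_cases hz : κ z < K'
      · simp [indicator, J1, J2, hz, not_le.2 hz]
      · simp [indicator, J1, J2, hz, not_lt.1 hz]
    have : I ((κ ⁻¹' Ici K').indicator (f n)) - I ((κ ⁻¹' Ici K').indicator (f m))
        = (lam n J2 - lam m J2) - (lam n J1 - lam m J1) := by
      rw [hdec, hdec]; abel
    rw [this]
    linarith [hq.sub_le (lam n J2 - lam m J2) (lam n J1 - lam m J1), h1 n hn m hm, h2 n hn m hm]
  obtain ⟨K', hK', hN'⟩ : ∃ K' ≥ K, q (I ((κ ⁻¹' Ici K').indicator (f N))) ≤ ε := by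
    have : Tendsto (fun k => I ((κ ⁻¹' Ici k).indicator (f N))) atTop (𝓝 (I 0)) := by
      refine hI.tendsto_of_dominated (hf N).abs
        (fun i => ((hfm N).indicator (hsm _)).aestronglyMeasurable) 
        (fun i => Eventually.of_forall fun z => norm_indicator_le_norm_self (f N) z) ?_
      · refine Eventually.of_forall fun z => tendsto_const_nhds.congr' ?_
        filter_upwards [eventually_gt_atTop (κ z)] with i hi
        simp [hi]
    rw [hI0] at this
    have := ((hq.tendsto_zero this).eventually (Iic_mem_nhds hε)).and (eventually_ge_atTop K)
    obtain ⟨K', h1, h2⟩ := this.exists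
    exact ⟨K', h2, h1⟩
  -- Below level `K'` the whole sequence is dominated by the constant `K'` on the finite-measure set
  -- `S K'`.
  have hbulk : Tendsto (fun n => q (I ((κ ⁻¹' Iio K').indicator (f n)))) atTop (𝓝 0) := by
    refine hq.tendsto_zero ?_
    rw [← hI0]
    refine hI.tendsto_of_dominated (memL1L2_indicator_const (hS K') (hSc K') (K' : ℝ))
      (fun i => ((hfm i).indicator (hsm _)).aestronglyMeasurable) (fun i => ?_) ?_
    · filter_upwards [hκS] with z hz
      by_cases hz' : κ z < K'
      · obtain ⟨h1, h2⟩ := hz K' hz'.le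
        simpa [indicator, hz', h1] using h2 i
      · simp only [indicator, mem_preimage, mem_Iio, hz', if_false, abs_zero]
        split_ifs <;> positivity
    · filter_upwards [hlim] with z hz
      by_cases hz' : κ z < K'
      · simpa [indicator, hz'] using hz
      · simp [indicator, hz']
  obtain ⟨M, hM⟩ := eventually_atTop.1 (hbulk.eventually (Iic_mem_nhds hε))
  refine ⟨max M N, fun n hn => ?_⟩
  rw [Real.dist_eq, sub_zero, abs_of_nonneg (hq.nonneg _)]
  have h1 := hM n (le_of_max_le_left hn)
  have h2 := htail K' hK' n (le_of_max_le_right hn) N le_rfl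
  have h3 : I (f n) = I ((κ ⁻¹' Iio K').indicator (f n)) +
      ((I ((κ ⁻¹' Ici K').indicator (f n)) - I ((κ ⁻¹' Ici K').indicator (f N)))
        + I ((κ ⁻¹' Ici K').indicator (f N))) := by
    rw [sub_add_cancel, ← hI.add _ _ ((hf n).indicator (hsm _)) ((hf n).indicator (hsm _))]
    congr 1
    ext z
    by_cases hz : κ z < K'
    · simp [indicator, hz, not_le.2 hz]
    · simp [indicator, hz, not_lt.1 hz]
  rw [h3]
  have h4 := hq.add_le (I ((κ ⁻¹' Iio K').indicator (f n)))
    ((I ((κ ⁻¹' Ici K').indicator (f n)) - I ((κ ⁻¹' Ici K').indicator (f N)))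
        + I ((κ ⁻¹' Ici K').indicator (f N)))
  have h5 := hq.add_le (I ((κ ⁻¹' Ici K').indicator (f n)) - I ((κ ⁻¹' Ici K').indicator (f N)))
    (I ((κ ⁻¹' Ici K').indicator (f N)))
  have h1' : q (I ((κ ⁻¹' Iio K').indicator (f n))) ≤ ε := h1
  linarith

end VitaliHahnSaks

/-! ### Convergence in probability -/

section TruncExp

variable {Ω : Type*} [MeasurableSpace Ω] {P : Measure Ω}

/-- The truncated expectation `E min(|X|, 1)`, which metrizes convergence in probability. -/
noncomputable def truncExp (P : Measure Ω) (X : Lp ℝ 2 P) : ℝ := ∫ ω, min |X ω| 1 ∂P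

theorem integrable_min_abs_one [IsProbabilityMeasure P] {X : Ω → ℝ} (hX : AEStronglyMeasurable X P) :
    Integrable (fun ω => min |X ω| 1) P := by
  refine Integrable.of_bound (C := 1) ?_ (Eventually.of_forall fun ω => ?_)
  · exact (hX.norm.inf aestronglyMeasurable_const : AEStronglyMeasurable (fun ω => min ‖X ω‖ 1) P)
  · rw [Real.norm_eq_abs, abs_of_nonneg (le_min (abs_nonneg _) zero_le_one)]
    exact min_le_right _ _

/-- `min(·, 1)` is subadditive on nonnegative reals, and on a probability space the `L¹` norm is at
most the `L²` norm. This lets the Vitali–Hahn–Saks argument combine `L²` estimates with a Cauchy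
property in probability. -/
theorem isSubNorm_truncExp [IsProbabilityMeasure P] : IsSubNorm (truncExp P) where
  le_norm X := by
    have h1 : Integrable X P := (Lp.memLp X).integrable (by norm_num)
    have h2 : ∫ ω, |X ω| ∂P ≤ ‖X‖ := by
      have h3 : eLpNorm X 1 P ≤ eLpNorm X 2 P :=
        eLpNorm_le_eLpNorm_of_exponent_le (by norm_num) (Lp.aestronglyMeasurable X)
      rw [Lp.norm_def]
      have h4 : ∫ ω, |X ω| ∂P = (eLpNorm X 1 P).toReal := by
        rw [eLpNorm_one_eq_lintegral_enorm]
        exact integral_norm_eq_lintegral_enorm (Lp.aestronglyMeasurable X)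
      rw [h4]
      exact ENNReal.toReal_mono (Lp.eLpNorm_ne_top X) h3
    refine (integral_mono (integrable_min_abs_one (Lp.aestronglyMeasurable X)) h1.abs fun ω => ?_).trans h2
    exact min_le_left _ _
  add_le X Y := by
    have hX := integrable_min_abs_one (Lp.aestronglyMeasurable X)
    have hY := integrable_min_abs_one (Lp.aestronglyMeasurable Y)
    unfold truncExp
    rw [← integral_add hX hY]
    refine integral_mono_ae (integrable_min_abs_one (Lp.aestronglyMeasurable (X + Y)))
      (hX.add hY) ?_
    filter_upwards [Lp.coeFn_add X Y] with ω hω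
    rw [hω, Pi.add_apply]
    have := abs_add_le (X ω) (Y ω)
    have := abs_nonneg (X ω)
    have := abs_nonneg (Y ω)
    rcases le_total |X ω| 1 with h1 | h1 <;> rcases le_total |Y ω| 1 with h2 | h2 <;>
      simp only [min_eq_left, min_eq_right, h1, h2] <;>
      [exact (min_le_left _ _).trans (by linarith); exact (min_le_right _ _).trans (by linarith);
        exact (min_le_right _ _).trans (by linarith); exact (min_le_right _ _).trans (by linarith)]
  neg X := by
    refine integral_congr_ae ?_
    filter_upwards [Lp.coeFn_neg X] with ω hω
    rw [hω, Pi.neg_apply, abs_neg]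
  nonneg X := integral_nonneg fun ω => le_min (abs_nonneg _) zero_le_one

/-- The limit `Z` need not be in `L²`, so it enters only through the triangle inequality. Off `s`
the difference is below `ε / 3`; on `s`, of mass at most `2ε / 3`, the truncation is at most 1. -/
theorem truncExp_sub_le_of_tendstoInMeasure [IsProbabilityMeasure P] {X : ℕ → Lp ℝ 2 P}
    {Z : Ω → ℝ} (h : TendstoInMeasure P (fun n => ⇑(X n)) atTop Z) {ε : ℝ} (hε : 0 < ε) :
    ∃ N, ∀ n ≥ N, ∀ m ≥ N, truncExp P (X n - X m) ≤ ε := by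
  rw [tendstoInMeasure_iff_measureReal_norm] at h
  obtain ⟨N, hN⟩ := eventually_atTop.1
    ((h (ε / 6) (by positivity)).eventually (Iic_mem_nhds (show (0 : ℝ) < ε / 3 by positivity)))
  refine ⟨N, fun n hn m hm => ?_⟩
  have hn' : P.real {ω | ε / 6 ≤ ‖X n ω - Z ω‖} ≤ ε / 3 := hN n hn
  have hm' : P.real {ω | ε / 6 ≤ ‖X m ω - Z ω‖} ≤ ε / 3 := hN m hm
  set s : Set Ω := {ω | ε / 3 ≤ |X n ω - X m ω|}
  have hs : MeasurableSet s := measurableSet_le measurable_const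
    ((Lp.stronglyMeasurable (X n)).measurable.sub (Lp.stronglyMeasurable (X m)).measurable).abs
  have hsP : P.real s ≤ ε / 3 + ε / 3 := by
    refine (measureReal_mono (s₂ := {ω | ε / 6 ≤ ‖X n ω - Z ω‖} ∪ {ω | ε / 6 ≤ ‖X m ω - Z ω‖})
      fun ω hω => ?_).trans ((measureReal_union_le _ _).trans (add_le_add hn' hm'))
    by_contra hcon
    simp only [mem_union, Set.mem_ofPred_eq, not_or, not_le, Real.norm_eq_abs] at hcon
    have hω' : ε / 3 ≤ |X n ω - X m ω| := hω
    have h1 := abs_sub_le (X n ω) (Z ω) (X m ω)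
    rw [abs_sub_comm (Z ω)] at h1
    linarith [hcon.1, hcon.2]
  calc truncExp P (X n - X m) ≤ ∫ ω, (ε / 3 + s.indicator (fun _ => (1 : ℝ)) ω) ∂P := by
        refine integral_mono_ae (integrable_min_abs_one (Lp.aestronglyMeasurable (X n - X m)))
          ((integrable_const _).add ((integrable_const _).indicator hs)) ?_
        filter_upwards [Lp.coeFn_sub (X n) (X m)] with ω hω
        rw [hω, Pi.sub_apply]
        by_cases hωs : ω ∈ s
        · rw [indicator_of_mem hωs]
          exact (min_le_right _ _).trans (by linarith)
        · rw [indicator_of_notMem hωs, add_zero]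
          exact (min_le_left _ _).trans (not_le.1 hωs).le
    _ = ε / 3 + P.real s := by
        rw [integral_add (integrable_const _) ((integrable_const _).indicator hs),
          integral_indicator_const _ hs]
        simp
    _ ≤ ε := by linarith

theorem tendstoInMeasure_zero_of_truncExp [IsProbabilityMeasure P] {X : ℕ → Lp ℝ 2 P}
    (h : Tendsto (fun n => truncExp P (X n)) atTop (𝓝 0)) :
    TendstoInMeasure P (fun n => ⇑(X n)) atTop 0 := by
  rw [tendstoInMeasure_iff_measureReal_norm]
  intro ε hε
  -- Markov's inequality is used at level `min ε 1`, since the truncated variable never exceeds 1.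
  have hδ : 0 < min ε 1 := lt_min hε one_pos
  refine squeeze_zero (fun _ => measureReal_nonneg) (fun n => ?_)
    (by simpa using h.const_mul (min ε 1)⁻¹)
  have h1 := mul_meas_ge_le_integral_of_nonneg (μ := P) (f := fun ω => min |X n ω| 1)
    (Eventually.of_forall fun ω => le_min (abs_nonneg _) zero_le_one)
    (integrable_min_abs_one (Lp.aestronglyMeasurable (X n))) (min ε 1)
  have h2 : P.real {ω | ε ≤ ‖X n ω - (0 : Ω → ℝ) ω‖} ≤ P.real {ω | min ε 1 ≤ min |X n ω| 1} := by
    refine measureReal_mono fun ω hω => ?_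
    have hω' : ε ≤ |X n ω| := by simpa using hω
    exact min_le_min_right 1 hω'
  refine h2.trans ?_
  rw [← div_eq_inv_mul, le_div_iff₀ hδ, mul_comm]
  exact h1

end TruncExp

/-! ### Moments from the characteristic exponent -/

section Moments

theorem levyExponent_zero (a b : ℝ) (ν : Measure ℝ) : levyExponent a b ν 0 = 0 := by
  simp [levyExponent]

/-- For `|θ| < 1` the integrand is dominated by `2 min(1, z²)`: by Taylor for small jumps, trivially
for large ones. Continuity is needed to select the branch of the logarithm of the characteristic
function. -/
theorem continuousAt_levyExponent_zero (a b : ℝ) {ν : Measure ℝ} (hν : IsLevyMeasure ν) :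
    ContinuousAt (levyExponent a b ν) 0 := by
  unfold levyExponent
  refine ContinuousAt.add (by fun_prop) ?_
  have hint : Integrable (fun z : ℝ => min 1 (z ^ 2)) ν := by
    refine ⟨by fun_prop, ?_⟩
    rw [hasFiniteIntegral_iff_ofReal (Eventually.of_forall fun z => by positivity)]
    exact hν.2
  refine continuousAt_of_dominated (bound := fun z => 2 * min 1 (z ^ 2))
    (Eventually.of_forall fun θ => ?_) ?_ (hint.const_mul 2) (Eventually.of_forall fun z => ?_)
  · refine Measurable.aestronglyMeasurable ?_
    refine Measurable.sub (by fun_prop) (Measurable.const_mul ?_ _)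
    exact Measurable.ite (measurableSet_le (by fun_prop) (by fun_prop)) (by fun_prop) (by fun_prop)
  · filter_upwards [Metric.ball_mem_nhds (0 : ℝ) one_pos] with θ hθ
    refine Eventually.of_forall fun z => ?_
    have hθ' : |θ| ≤ 1 := by simpa using (mem_ball_zero_iff.1 hθ).le
    split_ifs with hz
    · have h1 : ‖Complex.I * (θ : ℂ) * z‖ = |θ| * |z| := by simp
      have h2 : |θ| * |z| ≤ |z| := mul_le_of_le_one_left (abs_nonneg z) hθ'
      refine (Complex.norm_exp_sub_one_sub_id_le (by rw [h1]; exact h2.trans hz)).trans ?_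
      rw [h1]
      have h3 : z ^ 2 ≤ 1 := by rw [← sq_abs]; exact pow_le_one₀ (abs_nonneg z) hz
      rw [min_eq_right h3]
      have h4 : (|θ| * |z|) ^ 2 ≤ |z| ^ 2 := pow_le_pow_left₀ (by positivity) h2 2
      rw [sq_abs] at h4
      nlinarith [sq_nonneg z]
    · have h3 : 1 ≤ z ^ 2 := by
        rw [← sq_abs]; exact one_le_pow₀ (not_le.1 hz).le
      rw [min_eq_left h3, mul_zero, sub_zero]
      refine (norm_sub_le _ _).trans ?_
      have : ‖Complex.exp (Complex.I * θ * z)‖ = 1 := by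
        rw [show Complex.I * (θ : ℂ) * z = ((θ * z : ℝ) : ℂ) * Complex.I by push_cast; ring]
        exact Complex.norm_exp_ofReal_mul_I _
      rw [this]
      norm_num
  · fun_prop

/-- The first two moments of a law whose characteristic function is a power of that of `σ`. -/
theorem moments_of_charFun_eq_exp_mul {μ σ : Measure ℝ} [IsProbabilityMeasure μ]
    [IsProbabilityMeasure σ] (hμ : MemLp id 2 μ) (hσ : MemLp id 2 σ) {ψ : ℝ → ℂ}
    (hψ : ContinuousAt ψ 0) (hψ0 : ψ 0 = 0) {r : ℝ}
    (h1 : ∀ θ, charFun μ θ = Complex.exp (r * ψ θ)) (h2 : ∀ θ, charFun σ θ = Complex.exp (ψ θ)) :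
    ∫ x, x ∂μ = r * ∫ x, x ∂σ ∧
    ∫ x, x ^ 2 ∂μ = r * ∫ x, x ^ 2 ∂σ + (r ^ 2 - r) * (∫ x, x ∂σ) ^ 2 := by
  have cμ : ContDiff ℝ 2 (charFun μ) := contDiff_charFun hμ
  have cσ : ContDiff ℝ 2 (charFun σ) := contDiff_charFun hσ
  have dμ : Differentiable ℝ (charFun μ) := cμ.differentiable (by norm_num)
  have dσ : Differentiable ℝ (charFun σ) := cσ.differentiable (by norm_num)
  have d2σ : Differentiable ℝ (deriv (charFun σ)) := cσ.differentiable_deriv_two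
  have hμ0 : charFun μ 0 = 1 := by simp
  have hσ0 : charFun σ 0 = 1 := by simp
  -- Near zero the imaginary part of `ψ` stays in `(-π, π)`, so `ψ` is the principal logarithm. Its
  -- smoothness is thus inherited from `charFun σ`.
  have hlog : ∀ᶠ θ in 𝓝 (0 : ℝ), ψ θ = Complex.log (charFun σ θ) := by
    have : ∀ᶠ θ in 𝓝 (0 : ℝ), ‖ψ θ‖ < 1 :=
      hψ.norm.eventually (Iio_mem_nhds (by simp [hψ0]))
    filter_upwards [this] with θ hθ
    have him := (Complex.abs_im_le_norm (ψ θ)).trans_lt hθ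
    rw [abs_lt] at him
    rw [h2, Complex.log_exp] <;> linarith [Real.pi_gt_three]
  have hslit : ∀ᶠ θ in 𝓝 (0 : ℝ), charFun σ θ ∈ Complex.slitPlane :=
    dσ.continuous.continuousAt.eventually
      (Complex.isOpen_slitPlane.mem_nhds (by rw [hσ0]; exact Complex.one_mem_slitPlane))
  have hder : deriv (charFun μ) =ᶠ[𝓝 0]
      fun θ => charFun μ θ * (r * (deriv (charFun σ) θ / charFun σ θ)) := by
    filter_upwards [hlog.eventually_nhds, hslit] with θ hθ hs
    have e1 : charFun μ =ᶠ[𝓝 θ] fun t => Complex.exp (r * Complex.log (charFun σ t)) := by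
      filter_upwards [hθ] with t ht
      rw [h1, ht]
    have e2 := (((dσ θ).hasDerivAt.clog_real hs).const_mul (r : ℂ)).cexp
    rw [e1.deriv_eq, e2.deriv, e1.self_of_nhds]
  have first : deriv (charFun μ) 0 =
      charFun μ 0 * (r * (deriv (charFun σ) 0 / charFun σ 0)) := hder.self_of_nhds
  have second : deriv (deriv (charFun μ)) 0 = deriv (charFun μ) 0 *
      (r * (deriv (charFun σ) 0 / charFun σ 0)) + charFun μ 0 * (r *
        ((deriv (deriv (charFun σ)) 0 * charFun σ 0 - deriv (charFun σ) 0 * deriv (charFun σ) 0) /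
          charFun σ 0 ^ 2)) := by
    rw [hder.deriv_eq]
    exact ((dμ 0).hasDerivAt.mul (((d2σ 0).hasDerivAt.div (dσ 0).hasDerivAt
      (by rw [hσ0]; exact one_ne_zero)).const_mul (r : ℂ))).deriv
  have m1 : ∀ {τ : Measure ℝ} [IsProbabilityMeasure τ], MemLp id 2 τ →
      deriv (charFun τ) 0 = Complex.I * ((∫ x, x ∂τ : ℝ) : ℂ) := fun {τ} _ hτ => by
    have := iteratedDeriv_charFun_zero (n := 1) (μ := τ)
      (hτ.mono_exponent (by norm_num))
    simpa using this
  have m2 : ∀ {τ : Measure ℝ} [IsProbabilityMeasure τ], MemLp id 2 τ →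
      deriv (deriv (charFun τ)) 0 = -((∫ x, x ^ 2 ∂τ : ℝ) : ℂ) := fun {τ} _ hτ => by
    have := iteratedDeriv_charFun_zero (n := 2) (μ := τ) hτ
    rw [iteratedDeriv_succ, iteratedDeriv_one] at this
    simpa using this
  rw [m1 hμ, m1 hσ, hμ0, hσ0] at first
  rw [m2 hμ, m2 hσ, m1 hμ, m1 hσ, hμ0, hσ0] at second
  have f1 : ∫ x, x ∂μ = r * ∫ x, x ∂σ := by
    have := congrArg Complex.im first
    simpa using this
  refine ⟨f1, ?_⟩
  rw [f1] at second
  have := congrArg Complex.re second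
  simp [pow_two] at this ⊢
  linarith

end Moments

/-! ### Linear maps with a prescribed Gram matrix -/

section Gram

open scoped InnerProductSpace in
/-- A family of vectors whose Gram matrix is `v` times that of a total family is the image of the
latter under `√v` times an isometry. -/
theorem exists_clm_of_gram {ι H K : Type*} [NormedAddCommGroup H] [InnerProductSpace ℝ H]
    [NormedAddCommGroup K] [InnerProductSpace ℝ K] [CompleteSpace K] {u : ι → H} {w : ι → K}
    {v : ℝ} (hv : 0 ≤ v) (hu : Dense (Submodule.span ℝ (range u) : Set H))
    (hgram : ∀ i j, ⟪w i, w j⟫_ℝ = v * ⟪u i, u j⟫_ℝ) :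
    ∃ T : H →L[ℝ] K, (∀ i, T (u i) = w i) ∧ ∀ x y, ⟪T x, T y⟫_ℝ = v * ⟪x, y⟫_ℝ := by
  let e := Finsupp.linearCombination ℝ u
  let f := Finsupp.linearCombination ℝ w
  have he : DenseRange e := by
    rw [DenseRange, ← LinearMap.coe_range, Finsupp.range_linearCombination]
    exact hu
  have hef : ∀ a b, ⟪f a, f b⟫_ℝ = v * ⟪e a, e b⟫_ℝ := fun a b => by
    simp only [e, f, Finsupp.linearCombination_apply, Finsupp.sum, sum_inner, inner_sum,
      inner_smul_left, inner_smul_right, hgram, Finset.mul_sum]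
    refine Finset.sum_congr rfl fun i _ => Finset.sum_congr rfl fun j _ => ?_
    ring
  -- The diagonal of the Gram identity. It makes `e a ↦ f a` well defined and bounded on a dense
  -- range, hence extendable.
  have hnorm : ∀ a, ‖f a‖ ≤ √v * ‖e a‖ := fun a => by
    have := hef a a
    rw [real_inner_self_eq_norm_sq, real_inner_self_eq_norm_sq] at this
    refine le_of_sq_le_sq ?_ (by positivity)
    rw [this, mul_pow, Real.sq_sqrt hv]
  have hT : ∀ a, f.extendOfNorm e (e a) = f a := f.extendOfNorm_eq he ⟨_, hnorm⟩
  refine ⟨f.extendOfNorm e, fun i => ?_, fun x y => ?_⟩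
  · have := hT (Finsupp.single i 1)
    simpa [e, f] using this
  · refine he.induction_on₂ (p := fun x y =>
      ⟪f.extendOfNorm e x, f.extendOfNorm e y⟫_ℝ = v * ⟪x, y⟫_ℝ) ?_ (fun a b => ?_) x y
    · exact isClosed_eq (by fun_prop) (by fun_prop)
    · rw [hT, hT, hef]

/-- In `L²`, the indicators of the measurable subsets of an exhausting sequence of sets of finite
measure are total. -/
theorem dense_span_indicator {α : Type*} [MeasurableSpace α] {c : Measure α} {𝒞 : Set (Set α)}
    (hm : ∀ s ∈ 𝒞, MeasurableSet s) (hc : ∀ s ∈ 𝒞, c s ≠ ∞) {S : ℕ → Set α} (hSm : Monotone S)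
    (hSu : ⋃ k, S k = univ) (hS : ∀ s, MeasurableSet s → ∀ k, s ∩ S k ∈ 𝒞) :
    Dense (Submodule.span ℝ (range fun s : 𝒞 =>
      indicatorConstLp 2 (hm s s.2) (hc s s.2) (1 : ℝ)) : Set (Lp ℝ 2 c)) := by
  rw [Submodule.dense_iff_topologicalClosure_eq_top, Submodule.topologicalClosure_eq_top_iff,
    Submodule.eq_bot_iff]
  intro f hf
  have h0 : ∀ s ∈ 𝒞, ∫ z in s, f z ∂c = 0 := fun s hs => by
    have h1 := (Submodule.mem_orthogonal _ f).1 hf _ (Submodule.subset_span ⟨⟨s, hs⟩, rfl⟩)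
    rwa [L2.inner_indicatorConstLp_one] at h1
  have hint : ∀ s, MeasurableSet s → c s < ∞ → IntegrableOn f s c := fun s hs hcs =>
    haveI : Fact (c s < ∞) := ⟨hcs⟩
    ((Lp.memLp f).restrict s).integrable (by norm_num)
  refine (Lp.eq_zero_iff_ae_eq_zero).2 (Lp.ae_eq_zero_of_forall_setIntegral_eq_zero f (by norm_num)
    (by norm_num) hint fun s hs hcs => ?_)
  -- The integral over `s` is the limit of those over `s ∩ S k`, which vanish by orthogonality.
  have hu : ⋃ k, s ∩ S k = s := by rw [← inter_iUnion, hSu, inter_univ]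
  have ht := tendsto_setIntegral_of_monotone (μ := c) (f := f) (s := fun k => s ∩ S k)
    (fun k => hm _ (hS s hs k)) (fun i j hij => inter_subset_inter_right _ (hSm hij))
    (by rw [hu]; exact hint s hs hcs)
  rw [hu] at ht
  refine tendsto_nhds_unique ht ?_
  simp only [h0 _ (hS s hs _), tendsto_const_nhds]

end Gram

section Basis

variable {d : ℕ} {Ω : Type*} [MeasurableSpace Ω] {P : Measure Ω}
  {L : Set (S d) → Ω → ℝ} {a b : ℝ} {ν : Measure ℝ} {π : Measure Rate}

/-! ### Bounded Borel sets -/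

/-- The centre `(0, 0, 1)` of the exhausting balls of `S`. -/
noncomputable def basePoint (d : ℕ) : S d := (0, 0, ⟨1, mem_Ioi.2 one_pos⟩)

theorem IsBddBorel.inter {E F : Set (S d)} (hE : MeasurableSet E) (hF : IsBddBorel F) :
    IsBddBorel (E ∩ F) :=
  ⟨hE.inter hF.1, hF.2.subset inter_subset_right⟩

theorem IsBddBorel.diff {E F : Set (S d)} (hE : IsBddBorel E) (hF : MeasurableSet F) :
    IsBddBorel (E \ F) :=
  ⟨hE.1.diff hF, hE.2.subset sdiff_subset⟩

theorem IsBddBorel.union {E F : Set (S d)} (hE : IsBddBorel E) (hF : IsBddBorel F) :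
    IsBddBorel (E ∪ F) :=
  ⟨hE.1.union hF.1, hE.2.union hF.2⟩

theorem isBddBorel_empty : IsBddBorel (∅ : Set (S d)) :=
  ⟨MeasurableSet.empty, Bornology.isBounded_empty⟩

theorem isBddBorel_closedBall (R : ℝ) : IsBddBorel (Metric.closedBall (basePoint d) R) :=
  ⟨measurableSet_closedBall, Metric.isBounded_closedBall⟩

theorem monotone_closedBall_nat : Monotone fun k : ℕ => Metric.closedBall (basePoint d) (k : ℝ) :=
  fun _ _ h => Metric.closedBall_subset_closedBall (by exact_mod_cast h)

/-! ### Additivity and moments of a Lévy basis -/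

/-- The partial sums `n L(∅)` converge, so their increments `L(∅)` tend to zero. -/
theorem levyBasis_empty (hL : IsLevyBasis P L) : L ∅ =ᵐ[P] 0 := by
  have h := hL.sigma_additive (fun _ => ∅) (fun _ => isBddBorel_empty)
    (fun _ _ _ => disjoint_empty _) (by simpa using isBddBorel_empty)
  filter_upwards [h] with ω hω
  simp only [iUnion_empty, Finset.sum_const, Finset.card_range, nsmul_eq_mul] at hω
  have h1 := hω.comp (tendsto_add_atTop_nat 1)
  have h2 := h1.sub hω
  simp only [Function.comp_apply, Nat.cast_add, Nat.cast_one, sub_self] at h2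
  refine tendsto_nhds_unique ?_ h2
  refine tendsto_const_nhds.congr fun n => ?_
  ring

theorem levyBasis_union (hL : IsLevyBasis P L) {E F : Set (S d)} (hE : IsBddBorel E)
    (hF : IsBddBorel F) (hEF : Disjoint E F) : L (E ∪ F) =ᵐ[P] L E + L F := by
  let G : ℕ → Set (S d) := fun n => if n = 0 then E else if n = 1 then F else ∅
  have hG : ⋃ n, G n = E ∪ F := by
    refine subset_antisymm (iUnion_subset fun n => ?_) (union_subset ?_ ?_)
    · simp only [G]
      split_ifs <;> simp
    · exact subset_iUnion G 0
    · exact subset_iUnion G 1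
  have h := hL.sigma_additive G (fun n => ?_) (fun i j hij => ?_) (hG ▸ hE.union hF)
  · rw [hG] at h
    filter_upwards [h, levyBasis_empty hL] with ω hω h0
    refine tendsto_nhds_unique hω (tendsto_const_nhds.congr' ?_)
    filter_upwards [eventually_ge_atTop 2] with n hn
    obtain ⟨k, rfl⟩ := Nat.exists_eq_add_of_le' hn
    rw [Finset.sum_range_succ', Finset.sum_range_succ']
    simp [G, h0, add_comm]
  · simp only [G]
    split_ifs
    exacts [hE, hF, isBddBorel_empty]
  · simp only [G]
    split_ifs <;> first | omega | simp | exact hEF | exact hEF.symm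

theorem covariance_congr_ae {X X' Z Z' : Ω → ℝ} (hX : X =ᵐ[P] X') (hZ : Z =ᵐ[P] Z') :
    cov[X, Z; P] = cov[X', Z'; P] := by
  unfold covariance
  rw [integral_congr_ae hX, integral_congr_ae hZ]
  refine integral_congr_ae ?_
  filter_upwards [hX, hZ] with ω h1 h2
  rw [h1, h2]

variable [IsProbabilityMeasure P] {σ : Measure ℝ}

theorem integral_levyBasis (hL : IsLevyBasis P L) (hQ : HasCharQuadruplet P L a b ν (control d π))
    (h2 : HasFiniteSecondMoments P L) (hσ : IsLevySeedLaw a b ν σ) (hσ2 : MemLp id 2 σ)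
    {E : Set (S d)} (hE : IsBddBorel E) :
    ∫ ω, L E ω ∂P = (control d π).real E * ∫ x, x ∂σ ∧
      ∫ ω, L E ω ^ 2 ∂P = (control d π).real E * Var[id; σ] +
        ((control d π).real E * ∫ x, x ∂σ) ^ 2 := by
  have := hσ.1
  have hm := (hL.measurable E hE).aemeasurable (μ := P)
  have := Measure.isProbabilityMeasure_map hm
  obtain ⟨e1, e2⟩ := moments_of_charFun_eq_exp_mul (μ := P.map (L E)) (σ := σ)
    ((memLp_map_measure_iff aestronglyMeasurable_id hm).2 (h2 E hE)) hσ2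
    (continuousAt_levyExponent_zero a b hQ.2.1) (levyExponent_zero a b ν) (hQ.2.2 E hE) hσ.2
  rw [integral_map hm (by fun_prop)] at e1 e2
  refine ⟨e1, ?_⟩
  rw [e2, variance_eq_sub hσ2]
  simp only [id_eq, Pi.pow_apply]
  ring

theorem variance_levyBasis (hL : IsLevyBasis P L) (hQ : HasCharQuadruplet P L a b ν (control d π))
    (h2 : HasFiniteSecondMoments P L) (hσ : IsLevySeedLaw a b ν σ) (hσ2 : MemLp id 2 σ)
    {E : Set (S d)} (hE : IsBddBorel E) :
    Var[L E; P] = (control d π).real E * Var[id; σ] := by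
  obtain ⟨e1, e2⟩ := integral_levyBasis hL hQ h2 hσ hσ2 hE
  rw [variance_eq_sub (h2 E hE)]
  simp only [Pi.pow_apply]
  rw [e1, e2]
  ring

/-- Splitting both sets along `E ∩ F` gives four covariances. Three belong to disjoint sets and
vanish by independence; the fourth is a variance. -/
theorem covariance_levyBasis (hL : IsLevyBasis P L) (hQ : HasCharQuadruplet P L a b ν (control d π))
    (h2 : HasFiniteSecondMoments P L) (hσ : IsLevySeedLaw a b ν σ) (hσ2 : MemLp id 2 σ)
    {E F : Set (S d)} (hE : IsBddBorel E) (hF : IsBddBorel F) :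
    cov[L E, L F; P] = (control d π).real (E ∩ F) * Var[id; σ] := by
  have hEF : IsBddBorel (E ∩ F) := IsBddBorel.inter hE.1 hF
  have hE' := hE.diff hF.1
  have hF' := hF.diff hE.1
  have e1 : L E =ᵐ[P] L (E ∩ F) + L (E \ F) := by
    have := levyBasis_union hL hEF hE' (disjoint_sdiff_right.mono_left inter_subset_right)
    rwa [inter_union_sdiff] at this
  have e2 : L F =ᵐ[P] L (E ∩ F) + L (F \ E) := by
    have := levyBasis_union hL hEF hF' (disjoint_sdiff_right.mono_left inter_subset_left)
    rwa [inter_comm E F, inter_union_sdiff, inter_comm F E] at this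
  have i1 : cov[L (E ∩ F), L (F \ E); P] = 0 := (hL.indep _ _ hEF hF'
    (disjoint_sdiff_right.mono_left inter_subset_left)).covariance_eq_zero (h2 _ hEF) (h2 _ hF')
  have i2 : cov[L (E \ F), L (E ∩ F); P] = 0 := (hL.indep _ _ hE' hEF
    (disjoint_sdiff_left.mono_right inter_subset_right)).covariance_eq_zero (h2 _ hE') (h2 _ hEF)
  have i3 : cov[L (E \ F), L (F \ E); P] = 0 := (hL.indep _ _ hE' hF'
    (disjoint_sdiff_left.mono_right sdiff_subset)).covariance_eq_zero (h2 _ hE') (h2 _ hF')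
  rw [covariance_congr_ae e1 e2, covariance_add_left (h2 _ hEF) (h2 _ hE')
    ((h2 _ hEF).add (h2 _ hF')), covariance_add_right (h2 _ hEF) (h2 _ hEF) (h2 _ hF'),
    covariance_add_right (h2 _ hE') (h2 _ hEF) (h2 _ hF'), i1, i2, i3,
    covariance_self (h2 _ hEF).aestronglyMeasurable.aemeasurable,
    variance_levyBasis hL hQ h2 hσ hσ2 hEF]
  ring

/-! ### The integral on `L¹ ∩ L²` -/

variable [IsProbabilityMeasure π]

theorem control_closedBall_lt_top (R : ℝ) : control d π (Metric.closedBall (basePoint d) R) < ∞ := by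
  rw [basePoint, ← closedBall_prod_same, ← closedBall_prod_same, control, Measure.prod_prod,
    Measure.prod_prod]
  exact ENNReal.mul_lt_top measure_closedBall_lt_top
    (ENNReal.mul_lt_top measure_closedBall_lt_top (measure_lt_top _ _))

theorem IsBddBorel.control_ne_top {E : Set (S d)} (hE : IsBddBorel E) : control d π E ≠ ∞ := by
  obtain ⟨R, hR⟩ := hE.2.subset_closedBall (basePoint d)
  exact ((measure_mono hR).trans_lt (control_closedBall_lt_top R)).ne

variable (d π) in
/-- There is a bounded Borel set of unit control measure. -/
theorem exists_control_eq_one : ∃ E : Set (S d), IsBddBorel E ∧ (control d π).real E = 1 := by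
  have hpos : ∃ n : ℕ, 0 < π (Metric.closedBall (⟨1, mem_Ioi.2 one_pos⟩ : Rate) n) := by
    by_contra! h
    have h1 : π (⋃ n : ℕ, Metric.closedBall (⟨1, mem_Ioi.2 one_pos⟩ : Rate) n) = 0 :=
      measure_iUnion_null fun n => le_antisymm (h n) bot_le
    rw [Metric.iUnion_closedBall_nat, measure_univ] at h1
    exact one_ne_zero h1
  obtain ⟨n, hn⟩ := hpos
  set B : Set Rate := Metric.closedBall (⟨1, mem_Ioi.2 one_pos⟩ : Rate) n
  set V : Set (Space d) := Metric.closedBall 0 1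
  have hV : 0 < (volume : Measure (Space d)).real V :=
    ENNReal.toReal_pos (Metric.measure_closedBall_pos volume 0 one_pos).ne'
      measure_closedBall_lt_top.ne
  have hB : 0 < π.real B := ENNReal.toReal_pos hn.ne' (measure_ne_top _ _)
  -- The length of the time interval normalizes the measure of the product to 1.
  refine ⟨V ×ˢ (Icc 0 ((volume : Measure (Space d)).real V * π.real B)⁻¹ ×ˢ B),
    ⟨measurableSet_closedBall.prod (measurableSet_Icc.prod measurableSet_closedBall),
      Metric.isBounded_closedBall.prod ((Metric.isBounded_Icc _ _).prod
        Metric.isBounded_closedBall)⟩, ?_⟩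
  rw [control, measureReal_prod_prod, measureReal_prod_prod, Real.volume_real_Icc_of_le
    (by positivity)]
  field_simp
  simp

/-- The seed law is realized by the value of the basis at a set of unit control measure. -/
theorem exists_seedLaw (hL : IsLevyBasis P L) (hQ : HasCharQuadruplet P L a b ν (control d π))
    (h2 : HasFiniteSecondMoments P L) : ∃ σ : Measure ℝ, IsLevySeedLaw a b ν σ ∧ MemLp id 2 σ := by
  obtain ⟨E, hE, hE1⟩ := exists_control_eq_one d π
  refine ⟨P.map (L E), ⟨Measure.isProbabilityMeasure_map (hL.measurable E hE).aemeasurable,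
    fun θ => ?_⟩, ?_⟩
  · rw [hQ.2.2 E hE θ, hE1, Complex.ofReal_one, one_mul]
  · exact (memLp_map_measure_iff aestronglyMeasurable_id (hL.measurable E hE).aemeasurable).2
      (h2 E hE)

/-- The isometric part `T` integrates against the centred basis and is defined on all of `L²`; the
drift `m ∫ f` needs `f ∈ L¹`. Since `T` takes centred values, the two parts are orthogonal, so the
squared norm splits and the drift does not affect covariances. -/
theorem exists_isL2Integral (hL : IsLevyBasis P L)
    (hQ : HasCharQuadruplet P L a b ν (control d π)) (h2 : HasFiniteSecondMoments P L)
    (hσ : IsLevySeedLaw a b ν σ) (hσ2 : MemLp id 2 σ) :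
    ∃ I : (S d → ℝ) → Lp ℝ 2 P,
      IsL2Integral (control d π) Var[id; σ] ((∫ x, x ∂σ) ^ 2) I ∧
      (∀ (r : ℝ) (f : S d → ℝ), MemL1L2 f (control d π) → I (r • f) = r • I f) ∧
      (∀ E, IsBddBorel E → I (E.indicator fun _ => 1) =ᵐ[P] L E) ∧
      ∀ f g, MemL1L2 f (control d π) → MemL1L2 g (control d π) →
        cov[I f, I g; P] = Var[id; σ] * ∫ z, f z * g z ∂(control d π) := by
  set c := control d π with hc
  set m := ∫ x, x ∂σ with hm
  set v := Var[id; σ] with hv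
  have hcE : ∀ E : Set (S d), IsBddBorel E → c E ≠ ∞ := fun E hE => hE.control_ne_top
  let one : Lp ℝ 2 P := Lp.const 2 P 1
  have hone : one =ᵐ[P] fun _ => (1 : ℝ) := Lp.coeFn_const 2 P 1
  let u : {E : Set (S d) // IsBddBorel E} → Lp ℝ 2 c := fun E =>
    indicatorConstLp 2 E.2.1 (hcE E E.2) (1 : ℝ)
  let w : {E : Set (S d) // IsBddBorel E} → Lp ℝ 2 P := fun E =>
    (h2 E E.2).toLp (L E) - (c.real E * m) • one
  have hw : ∀ E, w E =ᵐ[P] fun ω => L E ω - ∫ ω', L E ω' ∂P := fun E => by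
    filter_upwards [Lp.coeFn_sub ((h2 E E.2).toLp (L E)) ((c.real E * m) • one),
      Lp.coeFn_smul (c.real E * m) one, (h2 E E.2).coeFn_toLp, hone] with ω e1 e2 e3 e4
    rw [e1, Pi.sub_apply, e2, Pi.smul_apply, e3, e4,
      (integral_levyBasis hL hQ h2 hσ hσ2 E.2).1, smul_eq_mul, mul_one]
  have hgram : ∀ E F, inner ℝ (w E) (w F) = v * inner ℝ (u E) (u F) := fun E F => by
    rw [L2.inner_indicatorConstLp_one, setIntegral_indicatorConstLp E.2.1, smul_eq_mul, mul_one,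
      L2.inner_def, inter_comm, mul_comm, ← covariance_levyBasis hL hQ h2 hσ hσ2 E.2 F.2]
    refine integral_congr_ae ?_
    filter_upwards [hw E, hw F] with ω e1 e2
    rw [e1, e2]
    simp [mul_comm]
  have hdense : Dense (Submodule.span ℝ (range u) : Set (Lp ℝ 2 c)) :=
    dense_span_indicator (𝒞 := {E | IsBddBorel E}) (fun s hs => hs.1) hcE
      monotone_closedBall_nat (Metric.iUnion_closedBall_nat _)
      (fun s hs k => IsBddBorel.inter hs (isBddBorel_closedBall _))
  obtain ⟨T, hTu, hT⟩ := exists_clm_of_gram (variance_nonneg _ _) hdense hgram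
  have hmean : ∀ x, ∫ ω, T x ω ∂P = inner ℝ one (T x) := fun x => by
    rw [L2.inner_def]
    refine integral_congr_ae ?_
    filter_upwards [hone] with ω e1
    rw [e1]
    simp
  have horth : ∀ x, inner ℝ one (T x) = 0 := fun x => by
    -- The expectation of `T x` is continuous in `x` and vanishes on the total family of indicators.
    have hz : ((innerSL ℝ one).comp T : Lp ℝ 2 c →L[ℝ] ℝ) = 0 := by
      refine ContinuousLinearMap.ext_on hdense ?_
      rintro _ ⟨E, rfl⟩
      have : ∫ ω, w E ω ∂P = 0 := by
        rw [integral_congr_ae (hw E), integral_sub ((h2 E E.2).integrable (by norm_num))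
          (integrable_const _)]
        simp
      rw [← hTu, hmean] at this
      simpa using this
    exact congrArg (fun φ : Lp ℝ 2 c →L[ℝ] ℝ => φ x) hz
  classical
  let I : (S d → ℝ) → Lp ℝ 2 P := fun f =>
    if h : MemLp f 2 c then T (h.toLp f) + ((∫ z, f z ∂c) * m) • one else 0
  have hI : ∀ f (h : MemLp f 2 c), I f = T (h.toLp f) + ((∫ z, f z ∂c) * m) • one :=
    fun f h => dif_pos h
  have hinner : ∀ f g (hf : MemLp f 2 c) (hg : MemLp g 2 c),
      inner ℝ (T (hf.toLp f)) (T (hg.toLp g)) = v * ∫ z, f z * g z ∂c := fun f g hf hg => by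
    rw [hT, L2.inner_def]
    congr 1
    refine integral_congr_ae ?_
    filter_upwards [hf.coeFn_toLp, hg.coeFn_toLp] with z e1 e2
    rw [e1, e2]
    simp [mul_comm]
  refine ⟨I, ⟨fun f g hf hg => ?_, fun f hf => ?_⟩, fun r f hf => ?_, fun E hE => ?_,
    fun f g hf hg => ?_⟩
  · rw [hI _ (hf.2.add hg.2), hI f hf.2, hI g hg.2, MemLp.toLp_add hf.2 hg.2, map_add]
    simp only [Pi.add_apply]
    rw [integral_add hf.1 hg.1, add_mul, add_smul]
    abel
  · have hone' : ‖one‖ ^ 2 = 1 := by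
      rw [← real_inner_self_eq_norm_sq, L2.inner_def,
        integral_congr_ae (g := fun _ => (1 : ℝ))]
      · simp
      · filter_upwards [hone] with ω e1
        simp [e1]
    rw [hI f hf.2, norm_add_sq_real, inner_smul_right, real_inner_comm, horth, norm_smul,
      mul_pow, hone', ← real_inner_self_eq_norm_sq, hinner f f hf.2 hf.2, Real.norm_eq_abs, sq_abs]
    simp only [pow_two]
    exact le_of_eq (by ring)
  · rw [hI _ (hf.2.const_smul r), hI f hf.2, MemLp.toLp_const_smul, map_smul]
    simp only [Pi.smul_apply, smul_eq_mul]
    rw [integral_const_mul, smul_add, smul_smul, mul_assoc]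
  · have hmem : MemLp (E.indicator fun _ => (1 : ℝ)) 2 c := (memL1L2_indicator_const hE.1
      (hcE E hE) 1).2
    have hu : hmem.toLp _ = u ⟨E, hE⟩ := rfl
    rw [hI _ hmem, hu, hTu, integral_indicator_const _ hE.1, smul_eq_mul, mul_one, sub_add_cancel]
    exact (h2 E hE).coeFn_toLp
  · have hcoe : ∀ f (hf : MemLp f 2 c),
        I f =ᵐ[P] fun ω => T (hf.toLp f) ω + (∫ z, f z ∂c) * m := fun f hf => by
      rw [hI f hf]
      filter_upwards [Lp.coeFn_add (T (hf.toLp f)) (((∫ z, f z ∂c) * m) • one),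
        Lp.coeFn_smul ((∫ z, f z ∂c) * m) one, hone] with ω e1 e2 e3
      rw [e1, Pi.add_apply, e2, Pi.smul_apply, e3, smul_eq_mul, mul_one]
    have hint : ∀ x, Integrable (T x) P := fun x => (Lp.memLp (T x)).integrable (by norm_num)
    rw [covariance_congr_ae (hcoe f hf.2) (hcoe g hg.2), covariance_add_const_left (hint _),
      covariance_add_const_right (hint _), covariance_eq_sub (Lp.memLp _) (Lp.memLp _),
      hmean, horth, zero_mul, sub_zero, ← hinner f g hf.2 hg.2, L2.inner_def]
    exact integral_congr_ae (Eventually.of_forall fun ω => mul_comm _ _)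

end Basis

/-! ### Stochastic integrals of `L¹ ∩ L²` functions -/

section StochIntegral

variable {d : ℕ} {Ω : Type*} [MeasurableSpace Ω] {P : Measure Ω}
  {L : Set (S d) → Ω → ℝ} {π : Measure Rate}

theorem SimpleFn.eval_eq_sum (h : SimpleFn d) (A : Set (S d)) :
    A.indicator h.eval = ∑ j, h.y j • (A ∩ h.E j).indicator fun _ => (1 : ℝ) := by
  ext z
  by_cases hz : z ∈ A
  · rw [indicator_of_mem hz, SimpleFn.eval, Finset.sum_apply]
    refine Finset.sum_congr rfl fun j _ => ?_
    by_cases hj : z ∈ h.E j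
    · simp [hj, indicator_of_mem (show z ∈ A ∩ h.E j from ⟨hz, hj⟩)]
    · simp [hj]
  · simp [Finset.sum_apply, hz]

theorem SimpleFn.measurable_eval (h : SimpleFn d) : Measurable h.eval :=
  Finset.measurable_fun_sum _ fun j _ => measurable_const.indicator (h.bddBorel j).1

variable [IsProbabilityMeasure π]

theorem memL1L2_sum_indicator {m : ℕ} (y : Fin m → ℝ) {E : Fin m → Set (S d)}
    (hE : ∀ j, IsBddBorel (E j)) (s : Finset (Fin m)) :
    MemL1L2 (∑ j ∈ s, y j • (E j).indicator fun _ => (1 : ℝ)) (control d π) := by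
  have h j := memL1L2_indicator_const (hE j).1 ((hE j).control_ne_top (π := π)) 1
  exact ⟨integrable_finsetSum' _ fun j _ => (h j).1.smul (y j),
    memLp_finsetSum' _ fun j _ => (h j).2.const_smul (y j)⟩

theorem SimpleFn.memL1L2_eval (h : SimpleFn d) : MemL1L2 h.eval (control d π) := by
  have := h.eval_eq_sum univ
  simp only [indicator_univ, univ_inter] at this
  rw [this]
  exact memL1L2_sum_indicator h.y h.bddBorel _

variable {A B : ℝ} {I : (S d → ℝ) → Lp ℝ 2 P}

theorem SimpleFn.integral_ae_eq (hI : IsL2Integral (control d π) A B I)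
    (hsmul : ∀ (r : ℝ) (f : S d → ℝ), MemL1L2 f (control d π) → I (r • f) = r • I f)
    (hIL : ∀ E, IsBddBorel E → I (E.indicator fun _ => 1) =ᵐ[P] L E)
    (h : SimpleFn d) {D : Set (S d)} (hD : MeasurableSet D) :
    I (D.indicator h.eval) =ᵐ[P] h.integral L D := by
  have hb j : IsBddBorel (D ∩ h.E j) := IsBddBorel.inter hD (h.bddBorel j)
  have key : ∀ s : Finset (Fin h.m),
      I (∑ j ∈ s, h.y j • (D ∩ h.E j).indicator fun _ => (1 : ℝ)) =ᵐ[P]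
        fun ω => ∑ j ∈ s, h.y j * L (D ∩ h.E j) ω := fun s => by
    classical
    induction s using Finset.induction_on with
    | empty =>
      have h0 : MemL1L2 (0 : S d → ℝ) (control d π) := ⟨integrable_zero _ _ _, MemLp.zero⟩
      have : I 0 = 0 := by simpa using hI.sub h0 h0
      simp only [Finset.sum_empty, this]
      exact Lp.coeFn_zero ℝ 2 P
    | insert j s hj ih =>
      have hm := memL1L2_indicator_const (hb j).1 ((hb j).control_ne_top (π := π)) 1
      rw [Finset.sum_insert hj, hI.add _ _ ⟨hm.1.smul (h.y j), hm.2.const_smul (h.y j)⟩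
        (memL1L2_sum_indicator h.y hb s), hsmul _ _ hm]
      filter_upwards [ih, hIL _ (hb j), Lp.coeFn_smul (h.y j)
        (I ((D ∩ h.E j).indicator fun _ => (1 : ℝ))), Lp.coeFn_add (h.y j •
        I ((D ∩ h.E j).indicator fun _ => (1 : ℝ)))
        (I (∑ j ∈ s, h.y j • (D ∩ h.E j).indicator fun _ => (1 : ℝ)))] with ω e1 e2 e3 e4
      rw [e4, Pi.add_apply, e3, Pi.smul_apply, e2, e1, Finset.sum_insert hj, smul_eq_mul]
  rw [h.eval_eq_sum]
  exact key Finset.univ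

variable [IsProbabilityMeasure P] in
/-- The stochastic integral of a function in `L¹ ∩ L²` agrees with the `L²` integral, whatever the
approximating simple functions. -/
theorem IsStochIntegral.ae_eq (hI : IsL2Integral (control d π) A B I)
    (hsmul : ∀ (r : ℝ) (f : S d → ℝ), MemL1L2 f (control d π) → I (r • f) = r • I f)
    (hIL : ∀ E, IsBddBorel E → I (E.indicator fun _ => 1) =ᵐ[P] L E)
    {h : S d → ℝ} (hh : MemL1L2 h (control d π)) {Z : Ω → ℝ}
    (hZ : IsStochIntegral P L (control d π) h Z) : Z =ᵐ[P] I h := by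
  obtain ⟨hm, hn, hlim, hA, hZ⟩ := hZ
  have hmem n : MemL1L2 (hn n).eval (control d π) := (hn n).memL1L2_eval
  have hsimp n {D : Set (S d)} (hD : MeasurableSet D) :=
    (hn n).integral_ae_eq hI hsmul hIL hD
  -- Subtracting `h` shifts the integrals over `D` by the fixed vector `I (D.indicator h)`, so they
  -- remain Cauchy while the integrands now tend to zero.
  have hmain : Tendsto (fun n => truncExp P (I ((hn n).eval - h))) atTop (𝓝 0) := by
    refine hI.tendsto_zero_of_cauchy isSubNorm_truncExp
      (fun n => (hn n).measurable_eval.sub hm) (fun n => (hmem n).sub hh)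
      (fun k => measurableSet_closedBall) monotone_closedBall_nat
      (Metric.iUnion_closedBall_nat (basePoint d))
      (fun k => (control_closedBall_lt_top _).ne) ?_ fun D hD ε hε => ?_
    · filter_upwards [hlim] with z hz
      simpa using hz.sub_const (h z)
    · obtain ⟨ZA, hZA⟩ := hA D hD
      obtain ⟨N, hN⟩ := truncExp_sub_le_of_tendstoInMeasure
        (hZA.congr_left fun n => (hsimp n hD).symm) hε
      refine ⟨N, fun n hn' m hm' => ?_⟩
      rw [indicator_sub', indicator_sub', hI.sub ((hmem n).indicator hD) (hh.indicator hD),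
        hI.sub ((hmem m).indicator hD) (hh.indicator hD), sub_sub_sub_cancel_right]
      exact hN n hn' m hm'
  have h1 := tendstoInMeasure_zero_of_truncExp hmain
  have h2 : TendstoInMeasure P (fun n => (hn n).integral L univ) atTop (I h) := by
    have h3 : TendstoInMeasure P (fun n ω => (hn n).integral L univ ω - I h ω) atTop 0 := by
      refine h1.congr_left fun n => ?_
      have h4 := hsimp n MeasurableSet.univ
      rw [indicator_univ] at h4
      rw [hI.sub (hmem n) hh]
      filter_upwards [h4, Lp.coeFn_sub (I (hn n).eval) (I h)] with ω e1 e2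
      rw [e2, Pi.sub_apply, e1]
    rw [tendstoInMeasure_iff_norm] at h3 ⊢
    simpa using h3
  exact tendstoInMeasure_ae_unique hZ h2

end StochIntegral

/-! ### Volumes of lenses -/

/-- A reflection `R` takes `q - p` to `q' - p'`, these having equal norms. The rigid motion `ξ ↦ p'
+ R (ξ - p)` preserves volume and carries one lens onto the other. -/
theorem lensVolume_eq_of_dist {d : ℕ} {p q p' q' : Space d} (h : dist p q = dist p' q') (r : ℝ) :
    lensVolume p q r = lensVolume p' q' r := by
  obtain ⟨R, hR⟩ : ∃ R : Space d ≃ₗᵢ[ℝ] Space d, R (q - p) = q' - p' :=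
    ⟨_, Submodule.reflection_sub (by
      rw [← dist_eq_norm, ← dist_eq_norm, dist_comm q p, dist_comm q' p', h])⟩
  have hmp : MeasurePreserving (fun ξ => p' + R (ξ - p)) (volume : Measure (Space d)) volume :=
    (measurePreserving_add_left volume p').comp
      (R.measurePreserving.comp (measurePreserving_sub_right volume p))
  have hpre : (fun ξ => p' + R (ξ - p)) ⁻¹' (Metric.closedBall p' r ∩ Metric.closedBall q' r) =
      Metric.closedBall p r ∩ Metric.closedBall q r := by
    ext ξ
    have e : p' + R (ξ - p) - q' = R (ξ - q) := by
      rw [show ξ - q = (ξ - p) - (q - p) by abel, map_sub R (ξ - p) (q - p), hR]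
      abel
    simp only [mem_preimage, mem_inter_iff, Metric.mem_closedBall, dist_eq_norm, e,
      add_sub_cancel_left, R.norm_map]
  rw [lensVolume, lensVolume, measureReal_def, measureReal_def, ← hpre, hmp.measure_preimage
    (measurableSet_closedBall.inter measurableSet_closedBall).nullMeasurableSet]

/-- The substitution `u = t - s` removes `t` from the covariance, so that one function `C` serves
all times. -/
theorem setIntegral_Iic_comp_sub_left (F : ℝ → ℝ) (t : ℝ) :
    ∫ s in Iic t, F (t - s) = ∫ u in Ici 0, F u := by
  rw [← integral_indicator measurableSet_Iic, ← integral_indicator measurableSet_Ici,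
    ← integral_sub_left_eq_self _ volume t]
  congr 1
  ext s
  simp [indicator]

/-! ### Kernels of the `g`-class -/

section Kernel

variable {d : ℕ} {π : Measure Rate}

theorem memL1L2_kernel {A : ℝ → Space d → Set (Space d × ℝ)} {t : ℝ} {x : Space d}
    (hm : Measurable (kernel A t x))
    (h1 : ∫⁻ z in cylinder (A t x),
      ENNReal.ofReal (Real.exp (-(z.2.2 : ℝ) * (t - z.2.1))) ∂(control d π) < ∞)
    (h2 : ∫⁻ z in cylinder (A t x),
      ENNReal.ofReal (Real.exp (-2 * (z.2.2 : ℝ) * (t - z.2.1))) ∂(control d π) < ∞) :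
    MemL1L2 (kernel A t x) (control d π) := by
  -- The exponential never vanishes, so the cylinder is the set where the measurable kernel is
  -- nonzero.
  have hc : MeasurableSet (cylinder (A t x)) := by
    have : cylinder (A t x) = kernel A t x ⁻¹' {0}ᶜ := by
      ext z
      by_cases hz : z ∈ cylinder (A t x) <;> simp [kernel, hz]
    rw [this]
    exact hm (measurableSet_singleton 0).compl
  refine ⟨⟨hm.aestronglyMeasurable, ?_⟩, ?_⟩
  · rw [hasFiniteIntegral_iff_enorm]
    refine lt_of_eq_of_lt ?_ h1
    rw [← lintegral_indicator hc]
    congr 1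
    ext z
    by_cases hz : z ∈ cylinder (A t x)
    · simp [kernel, hz, Real.enorm_eq_ofReal (Real.exp_pos _).le]
    · simp [kernel, hz]
  · rw [memLp_two_iff_integrable_sq hm.aestronglyMeasurable]
    refine ⟨(hm.pow_const 2).aestronglyMeasurable, ?_⟩
    rw [hasFiniteIntegral_iff_enorm]
    refine lt_of_eq_of_lt ?_ h2
    rw [← lintegral_indicator hc]
    congr 1
    ext z
    by_cases hz : z ∈ cylinder (A t x)
    · simp only [kernel, indicator_of_mem hz]
      rw [← Real.exp_nat_mul, Real.enorm_eq_ofReal (Real.exp_pos _).le]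
      congr 2
      push_cast
      ring
    · simp [kernel, hz]

variable [IsProbabilityMeasure π] {g : ℝ → ℝ}

/-- For fixed `s ≤ t` and rate, each kernel is a constant times the indicator of a ball of radius `g
(t - s)`; for `s > t` both vanish. -/
theorem integral_kernel_mul_kernel_section (t : ℝ) (x y : Space d) (w : ℝ × Rate) :
    ∫ ξ, kernel (gAmbit g) t x (ξ, w) * kernel (gAmbit g) t y (ξ, w) =
      (Iic t).indicator (fun s => lensVolume x y (g (t - s)) *
        Real.exp (-2 * (w.2 : ℝ) * (t - s))) w.1 := by
  obtain ⟨s, lam⟩ := w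
  by_cases hs : s ≤ t
  · have habs : |t - s| = t - s := abs_of_nonneg (sub_nonneg.2 hs)
    have : ∀ ξ : Space d, kernel (gAmbit g) t x (ξ, s, lam) * kernel (gAmbit g) t y (ξ, s, lam) =
        (Metric.closedBall x (g (t - s)) ∩ Metric.closedBall y (g (t - s))).indicator
          (fun _ => Real.exp (-2 * (lam : ℝ) * (t - s))) ξ := fun ξ => by
      have hk : ∀ x' : Space d, kernel (gAmbit g) t x' (ξ, s, lam) =
          (Metric.closedBall x' (g (t - s))).indicator
            (fun _ => Real.exp (-(lam : ℝ) * (t - s))) ξ := fun x' => by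
        simp [kernel, cylinder, gAmbit, indicator, hs, habs, dist_comm ξ, dist_eq_norm]
      rw [hk, hk, ← inter_indicator_mul]
      congr 1
      ext
      rw [← Real.exp_add]
      congr 1
      ring
    simp_rw [this]
    rw [integral_indicator_const _ (measurableSet_closedBall.inter measurableSet_closedBall),
      indicator_of_mem (mem_Iic.2 hs), smul_eq_mul, lensVolume]
  · have : ∀ ξ : Space d, kernel (gAmbit g) t x (ξ, s, lam) = 0 := fun ξ => by
      simp [kernel, cylinder, gAmbit, hs]
    simp [this, hs]

/-- The product of two `L²` kernels is integrable, so Fubini applies with space integrated first. It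
also supplies the measurability and integrability of the lens integrand. -/
theorem integral_kernel_mul_kernel {t : ℝ} {x y : Space d}
    (hx : MemL1L2 (kernel (gAmbit g) t x) (control d π))
    (hy : MemL1L2 (kernel (gAmbit g) t y) (control d π)) :
    Integrable (fun z : Rate × ℝ => lensVolume x y (g (t - z.2)) *
      Real.exp (-2 * (z.1 : ℝ) * (t - z.2))) (π.prod (volume.restrict (Iic t))) ∧
    ∫ z, kernel (gAmbit g) t x z * kernel (gAmbit g) t y z ∂(control d π) =
      ∫ lam : Rate, (∫ s in Iic t, lensVolume x y (g (t - s)) *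
        Real.exp (-2 * (lam : ℝ) * (t - s))) ∂π := by
  have hint : Integrable (fun z => kernel (gAmbit g) t x z * kernel (gAmbit g) t y z)
      ((volume : Measure (Space d)).prod ((volume : Measure ℝ).prod π)) :=
    hx.2.integrable_mul hy.2
  have h1 := hint.integral_prod_right
  simp only [integral_kernel_mul_kernel_section] at h1
  have hswap := h1.swap
  have hset : π.prod ((volume : Measure ℝ).restrict (Iic t)) =
      (π.prod volume).restrict (Prod.snd ⁻¹' Iic t) := by
    rw [← univ_prod, ← Measure.prod_restrict, Measure.restrict_univ]
  have h2 : Integrable (fun z : Rate × ℝ => lensVolume x y (g (t - z.2)) *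
      Real.exp (-2 * (z.1 : ℝ) * (t - z.2))) (π.prod (volume.restrict (Iic t))) := by
    rw [hset, ← IntegrableOn, ← integrable_indicator_iff (measurable_snd measurableSet_Iic)]
    exact hswap
  refine ⟨h2, ?_⟩
  rw [control, integral_prod_symm _ hint]
  simp only [integral_kernel_mul_kernel_section]
  rw [integral_prod_symm _ h1]
  congr 1
  ext lam
  exact integral_indicator measurableSet_Iic

end Kernel

end MSTOU

/-! ### Isotropy and the covariance formula -/

theorem mainTheorem5 {d : ℕ} (hd : 1 ≤ d)
    {Ω : Type*} [MeasurableSpace Ω] (P : Measure Ω) [IsProbabilityMeasure P]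
    (L : Set (MSTOU.S d) → Ω → ℝ) (a b : ℝ) (ν : Measure ℝ)
    (π : Measure MSTOU.Rate) [IsProbabilityMeasure π]
    (g : ℝ → ℝ) (hg0 : 0 ≤ g 0) (hgpos : ∀ w : ℝ, 0 < w → 0 < g w)
    (hgmono : MonotoneOn g (Set.Ici 0))
    (Y : ℝ → MSTOU.Space d → Ω → ℝ)
    (hY : MSTOU.IsMSTOU P L a b ν π (MSTOU.gAmbit g) Y) :
    MSTOU.IsIsotropic P Y ∧
    ∃ σ : Measure ℝ, MSTOU.IsLevySeedLaw a b ν σ ∧ MemLp id 2 σ ∧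
      ∀ (t : ℝ) (x dx p q : MSTOU.Space d), dist p q = ‖dx‖ →
        Integrable (fun z : MSTOU.Rate × ℝ =>
          MSTOU.lensVolume p q (g (t - z.2)) * Real.exp (-2 * (z.1 : ℝ) * (t - z.2)))
          (π.prod (volume.restrict (Set.Iic t))) ∧
        cov[Y t x, Y t (x + dx); P] =
          Var[id; σ] * ∫ lam : MSTOU.Rate, (∫ s in Set.Iic t,
            MSTOU.lensVolume p q (g (t - s)) * Real.exp (-2 * (lam : ℝ) * (t - s))) ∂π := by
  obtain ⟨σ, hσ, hσ2⟩ := MSTOU.exists_seedLaw hY.levyBasis hY.quadruplet hY.finiteSecondMoments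
  obtain ⟨I, hI, hsmul, hIL, hcov⟩ := MSTOU.exists_isL2Integral hY.levyBasis hY.quadruplet
    hY.finiteSecondMoments hσ hσ2
  have hk t x : MSTOU.MemL1L2 (MSTOU.kernel (MSTOU.gAmbit g) t x) (MSTOU.control d π) :=
    MSTOU.memL1L2_kernel (hY.integral_eq t x).1 (hY.integrable_one t x) (hY.integrable_two t x)
  have hYI t x : Y t x =ᵐ[P] I (MSTOU.kernel (MSTOU.gAmbit g) t x) :=
    (hY.integral_eq t x).ae_eq hI hsmul hIL (hk t x)
  have hY2 t x : MemLp (Y t x) 2 P := (memLp_congr_ae (hYI t x)).2 (Lp.memLp _)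
  have hlens : ∀ (t : ℝ) (x dx p q : MSTOU.Space d), dist p q = ‖dx‖ →
      Integrable (fun z : MSTOU.Rate × ℝ =>
        MSTOU.lensVolume p q (g (t - z.2)) * Real.exp (-2 * (z.1 : ℝ) * (t - z.2)))
        (π.prod (volume.restrict (Set.Iic t))) ∧
      cov[Y t x, Y t (x + dx); P] =
        Var[id; σ] * ∫ lam : MSTOU.Rate, (∫ s in Set.Iic t,
          MSTOU.lensVolume p q (g (t - s)) * Real.exp (-2 * (lam : ℝ) * (t - s))) ∂π := by
    intro t x dx p q hpq
    have hpq' : dist p q = dist x (x + dx) := by simp [hpq]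
    simp only [MSTOU.lensVolume_eq_of_dist hpq']
    obtain ⟨h1, h2⟩ := MSTOU.integral_kernel_mul_kernel (hk t x) (hk t (x + dx))
    rw [MSTOU.covariance_congr_ae (hYI t x) (hYI t (x + dx)), hcov _ _ (hk t x) (hk t (x + dx)),
      h2]
    exact ⟨h1, rfl⟩
  refine ⟨⟨hY2, ?_⟩, σ, hσ, hσ2, hlens⟩
  -- A unit vector, available since `d ≥ 1`: the centres `0` and `r • e` realize every distance `r ≥
  -- 0`, which defines `C`.
  let e : MSTOU.Space d := EuclideanSpace.single ⟨0, hd⟩ 1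
  have he : ‖e‖ = 1 := by simp [e]
  let C : ℝ → ℝ := fun r => Var[id; σ] * ∫ lam : MSTOU.Rate, (∫ u in Set.Ici 0,
    MSTOU.lensVolume 0 (r • e) (g u) * Real.exp (-2 * (lam : ℝ) * u)) ∂π
  have hC : ∀ (t : ℝ) (x dx : MSTOU.Space d), cov[Y t x, Y t (x + dx); P] = C ‖dx‖ := by
    intro t x dx
    rw [(hlens t x dx 0 (‖dx‖ • e) (by simp [norm_smul, he])).2]
    simp only [C]
    congr 2
    ext lam
    exact MSTOU.setIntegral_Iic_comp_sub_left (fun u =>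
      MSTOU.lensVolume 0 (‖dx‖ • e) (g u) * Real.exp (-2 * (lam : ℝ) * u)) t
  refine ⟨C, fun k x w => ?_, hC⟩
  have hC' : ∀ i j, C ‖x i - x j‖ = cov[Y 0 (x i), Y 0 (x j); P] := fun i j => by
    rw [norm_sub_rev, ← hC 0 (x i) (x j - x i), add_sub_cancel]
  have hw : ∀ i, MemLp (fun ω => w i * Y 0 (x i) ω) 2 P := fun i => (hY2 0 (x i)).const_mul (w i)
  -- Positive definiteness: the quadratic form is the variance of `∑ w i Y 0 (x i)`.
  have hvar : ∑ i, ∑ j, w i * w j * C ‖x i - x j‖ =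
      Var[fun ω => ∑ i, w i * Y 0 (x i) ω; P] := by
    rw [← covariance_self (memLp_finsetSum _ fun i _ => hw i).aestronglyMeasurable.aemeasurable,
      covariance_fun_sum_fun_sum hw hw]
    refine Finset.sum_congr rfl fun i _ => Finset.sum_congr rfl fun j _ => ?_
    rw [covariance_const_mul_left, covariance_const_mul_right, hC', mul_assoc]
  rw [hvar]
  exact variance_nonneg _ _
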